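/- **Setting.** Let $R>0$ and $n\ge 1$. For a probability measure $\mu$ on $[-R,R]^d$, the Boltzmann–Gibbs entropy is $H(\mu)=-\int_{[-R,R]^d}p\log p\,d\mathbf x\in[-\infty,\infty)$ if $\mu$ has a density $p$ with respect to Lebesgue measure, and $H(\mu)=-\infty$ otherwise. For $\mathbf x\in\mathbb R^N$ put $\kappa_N(\mathbf x)=\frac1N\sum_{j=1}^N x_j$. For probability measures $\mu_1,\dots,\mu_n$ on $[-R,R]$, an *approximating sequence* is a sequence $\Xi(N)=(\xi_1(N),\dots,\xi_n(N))$, $N\in\mathbb N$, of $n$-tuples of vectors $\xi_i(N)\in[-R,R]^N$ with increasing coordinates such that $\frac1N\sum_{j}\xi_i(N)_j^k\to\int x^k\,d\mu_i(x)$ as $N\to\infty$ for all $k$ and $i$; such sequences exist. The symmetric group acts by $\sigma(\mathbf x)=(x_{\sigma^{-1}(1)},\dots,x_{\sigma^{-1}(N)})$. For $h\in C_{\mathbb R}([-R,R]^n)$ the *mutual pressure* is $$P_{\mathrm{sym}}(h:\mu_1,\dots,\mu_n)=\limsup_{N\to\infty}\frac1N\log\Bigl[\frac1{(N!)^n}\sum_{\sigma_1,\dots,\sigma_n\in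 S_N}\exp\Bigl(\sum_{j=1}^N h\bigl(\sigma_1(\xi_1(N))_j,\dots,\sigma_n(\xi_n(N))_j\bigr)\Bigr)\Bigr].$$ For a probability measure $\mu$ on $[-R,R]^n$ with marginals $\mu_1,\dots,\mu_n$, its Legendre transform is $$\mathcal I_{\mathrm{sym}}(\mu)=\sup\{\mu(h)-P_{\mathrm{sym}}(h:\mu_1,\dots,\mu_n):h\in C_{\mathbb R}([-R,R]^n)\}.$$ Let $\Delta_{\mathrm{sym}}(\mu:\Xi(N);N,m,\delta)$ be the set of $(\sigma_1,\dots,\sigma_n)\in S_N^n$ such that the vectors $\mathbf x_i=\sigma_i(\xi_i(N))$ satisfy $|\kappa_N(\mathbf x_{i_1}\cdots\mathbf x_{i_k})-\int x_{i_1}\cdots x_{i_k}\,d\mu|<\delta$ (with pointwise products) for all $i_1,\dots,i_k\in\{1,\dots,n\}$ and $1\le k\le m$, and put $$I_{\mathrm{sym}}(\mu)=-\lim_{m\to\infty,\,\delta\searrow0}\ \limsup_{N\to\infty}\frac1N\log\frac{\#\Delta_{\mathrm{sym}}(\mu:\Xi(N);N,m,\delta)}{(N!)^n}\qquad(\log 0=-\infty).$$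 **Theorem 3.5.** For every probability measure $\mu$ on $[-R,R]^n$ with marginals $\mu_1,\dots,\mu_n$, and for any choice of the approximating sequences for $(\mu_1,\dots,\mu_n)$ used to compute $\mathcal I_{\mathrm{sym}}(\mu)$ and $I_{\mathrm{sym}}(\mu)$, $$H(\mu)=-\mathcal I_{\mathrm{sym}}(\mu)+\sum_{i=1}^nH(\mu_i)$$ in $[-\infty,\infty)$. Moreover, if $H(\mu_i)>-\infty$ for all $i=1,\dots,n$, then $$\mathcal I_{\mathrm{sym}}(\mu)=I_{\mathrm{sym}}(\mu)=S(\mu,\mu_1\otimes\cdots\otimes\mu_n),$$ where $S(\mu,\nu)\in[0,\infty]$ is the relative entropy (Kullback–Leibler divergence) of $\mu$ with respect to $\nu$, and $\mathcal I_{\mathrm{sym}}(\mu)=0$ if and only if $\mu=\mu_1\otimes\cdots\otimes\mu_n$, i.e., if and only if the coordinate variables $x_1,\dots,x_n$ are independent with respect to $\mu$. -/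

import Mathlib

open MeasureTheory Filter Topology

namespace MutualPressure

noncomputable section

/-- The interval `[-R, R]`. -/
abbrev Interval (R : ℝ) : Type := Set.Icc (-R) R

/-- The box `[-R, R]^n`. -/
abbrev Box (R : ℝ) (n : ℕ) : Type := Fin n → Interval R

/-- Lebesgue measure on `[-R, R]`. -/
def lebesgueInterval (R : ℝ) : Measure (Interval R) := Measure.comap Subtype.val volume

/-- Lebesgue measure on `[-R, R]^n`. -/
def lebesgueBox (R : ℝ) (n : ℕ) : Measure (Box R n) := Measure.pi fun _ => lebesgueInterval R

open Classical in
/-- Boltzmann-Gibbs entropy `H(μ) = -∫ p log p dL` if `μ` has a density `p` with respect to the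
reference measure `L`, and `-∞` otherwise. It is used for probability measures `μ` and finite
`L`; then `p log p ≥ -1/e`, so if `p log p` is not integrable, `∫ p log p dL = +∞` and
`H(μ) = -∞`. -/
def entropy {X : Type*} [MeasurableSpace X] (L μ : Measure X) : EReal :=
  if μ ≪ L ∧
      Integrable (fun x => (μ.rnDeriv L x).toReal * Real.log (μ.rnDeriv L x).toReal) L
  then ((-∫ x, (μ.rnDeriv L x).toReal * Real.log (μ.rnDeriv L x).toReal ∂L : ℝ) : EReal)
  else ⊥

/-- `H(μ)` for `μ` on `[-R, R]^n`. -/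
def entropyBox {R : ℝ} {n : ℕ} (μ : Measure (Box R n)) : EReal := entropy (lebesgueBox R n) μ

/-- `H(ν)` for `ν` on `[-R, R]`. -/
def entropyInterval {R : ℝ} (ν : Measure (Interval R)) : EReal := entropy (lebesgueInterval R) ν

/-- The `i`-th marginal of a measure on `[-R, R]^n`. -/
def marginal {R : ℝ} {n : ℕ} (μ : Measure (Box R n)) (i : Fin n) : Measure (Interval R) :=
  μ.map (fun x => x i)

/-- The mean value `κ_N(x) = (1/N) ∑_j x_j`. -/
def kappa {N : ℕ} (x : Fin N → ℝ) : ℝ := (1 / (N : ℝ)) * ∑ j, x j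

/-- `Ξ(N) = (ξ_1(N), …, ξ_n(N))` is an approximating sequence for `(ν_1, …, ν_n)`: each
`ξ_i(N) ∈ [-R, R]^N` has increasing coordinates, and `ξ_i(N) → ν_i` in moments. -/
structure IsApproximating {R : ℝ} {n : ℕ} (ν : Fin n → Measure (Interval R))
    (Ξ : (N : ℕ) → Fin n → Fin N → Interval R) : Prop where
  monotone : ∀ N i, Monotone (Ξ N i)
  tendsto_moment : ∀ (i : Fin n) (k : ℕ),
    Tendsto (fun N => kappa (fun j => (Ξ N i j : ℝ) ^ k)) atTop (𝓝 (∫ x, (x : ℝ) ^ k ∂(ν i)))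

/-- The action `(σ_1(ξ_1), …, σ_n(ξ_n))` of `S_N^n`, where
`σ(x) = (x_{σ⁻¹(1)}, …, x_{σ⁻¹(N)})`. -/
def permute {R : ℝ} {n N : ℕ} (σ : Fin n → Equiv.Perm (Fin N)) (ξ : Fin n → Fin N → Interval R) :
    Fin n → Fin N → Interval R :=
  fun i j => ξ i ((σ i)⁻¹ j)

/-- The set `Δ_R(μ; N, m, δ)` of microstates whose mixed moments up to order `m` are
`δ`-close to those of `μ`. -/
def microstates {R : ℝ} {n : ℕ} (μ : Measure (Box R n)) (N m : ℕ) (δ : ℝ) :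
    Set (Fin n → Fin N → Interval R) :=
  {x | ∀ k : ℕ, 1 ≤ k → k ≤ m → ∀ i : Fin k → Fin n,
    |kappa (fun j => ∏ l, (x (i l) j : ℝ)) - ∫ y, ∏ l, (y (i l) : ℝ) ∂μ| < δ}

/-- The set `Δ_sym(μ : Ξ(N); N, m, δ)` of discrete microstates. -/
def symMicrostates {R : ℝ} {n : ℕ} (μ : Measure (Box R n))
    (Ξ : (N : ℕ) → Fin n → Fin N → Interval R) (N m : ℕ) (δ : ℝ) :
    Set (Fin n → Equiv.Perm (Fin N)) :=
  {σ | permute σ (Ξ N) ∈ microstates μ N m δ}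

/-- `limsup_N (1/N) log γ_{S_N}^{⊗ n}(Δ_sym(μ : Ξ(N); N, m, δ))`, with `log 0 = -∞`, where
`γ_{S_N}` is the uniform probability measure on `S_N`. -/
def symRate {R : ℝ} {n : ℕ} (μ : Measure (Box R n))
    (Ξ : (N : ℕ) → Fin n → Fin N → Interval R) (m : ℕ) (δ : ℝ) : EReal :=
  limsup (fun N : ℕ =>
    (((1 / (N : ℝ)) : ℝ) : EReal) *
      ENNReal.log (((symMicrostates μ Ξ N m δ).ncard : ENNReal) / ((N.factorial : ENNReal) ^ n)))
    atTop

/-- `I_sym(μ) = -lim_{m → ∞, δ ↘ 0} limsup_N (1/N) log γ_{S_N}^{⊗ n}(Δ_sym(μ : Ξ(N); N, m, δ))`,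
computed along `Ξ`. The limit is monotone, so it is written as an infimum;
see `tendsto_symRate`. -/
def ISym {R : ℝ} {n : ℕ} (μ : Measure (Box R n))
    (Ξ : (N : ℕ) → Fin n → Fin N → Interval R) : EReal :=
  -⨅ (m : ℕ) (δ : ℝ) (_ : 0 < δ), symRate μ Ξ m δ

/-- The mutual pressure `P_sym(h : ν_1, …, ν_n)`, computed along an approximating sequence `Ξ`
for `(ν_1, …, ν_n)`. -/
def mutualPressure {R : ℝ} {n : ℕ} (Ξ : (N : ℕ) → Fin n → Fin N → Interval R)
    (h : C(Box R n, ℝ)) : EReal :=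
  limsup (fun N : ℕ =>
    (((1 / (N : ℝ)) * Real.log ((1 / ((N.factorial : ℝ) ^ n)) *
      ∑ σ : Fin n → Equiv.Perm (Fin N),
        Real.exp ((N : ℝ) * kappa (fun j => h (fun i => permute σ (Ξ N) i j)))) : ℝ) : EReal))
    atTop

/-- The Legendre transform of the mutual pressure,
`𝓘_sym(μ) = sup {μ(h) - P_sym(h : μ_1, …, μ_n) : h ∈ C_ℝ([-R, R]^n)}`, computed along an
approximating sequence `Ξ` for the marginals of `μ`. -/
def legendreISym {R : ℝ} {n : ℕ} (μ : Measure (Box R n))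
    (Ξ : (N : ℕ) → Fin n → Fin N → Interval R) : EReal :=
  ⨆ h : C(Box R n, ℝ), ((∫ x, h x ∂μ : ℝ) : EReal) - mutualPressure Ξ h

theorem symRate_mono {R : ℝ} {n : ℕ} (μ : Measure (Box R n))
    (Ξ : (N : ℕ) → Fin n → Fin N → Interval R) {m m' : ℕ} {δ δ' : ℝ} (hm : m' ≤ m)
    (hδ : δ ≤ δ') : symRate μ Ξ m δ ≤ symRate μ Ξ m' δ' := by
  refine limsup_le_limsup (Eventually.of_forall fun N => ?_)
  refine mul_le_mul_of_nonneg_left (ENNReal.log_monotone ?_) (by positivity)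
  refine ENNReal.div_le_div_right ?_ _
  have hs : symMicrostates μ Ξ N m δ ⊆ symMicrostates μ Ξ N m' δ' :=
    fun σ hσ k hk hk' i => (hσ k hk (hk'.trans hm) i).trans_le hδ
  exact_mod_cast Set.ncard_le_ncard hs (Set.toFinite _)

/-- The infimum in the definition of `ISym` is the limit as `m → ∞`, `δ ↘ 0`. -/
theorem tendsto_symRate {R : ℝ} {n : ℕ} (μ : Measure (Box R n))
    (Ξ : (N : ℕ) → Fin n → Fin N → Interval R) :
    Tendsto (fun p : ℕ × ℝ => symRate μ Ξ p.1 p.2) (atTop ×ˢ 𝓝[>] 0) (𝓝 (-ISym μ Ξ)) := by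
  rw [ISym, neg_neg]
  refine tendsto_order.2 ⟨fun a ha => ?_, fun a ha => ?_⟩
  · have : ∀ᶠ p : ℕ × ℝ in atTop ×ˢ 𝓝[>] 0, 0 < p.2 :=
      tendsto_snd.eventually (eventually_mem_nhdsWithin)
    filter_upwards [this] with p hp
    exact ha.trans_le ((iInf_le _ p.1).trans ((iInf_le _ p.2).trans (iInf_le _ hp)))
  · simp only [iInf_lt_iff] at ha
    obtain ⟨m, δ, hδ, h⟩ := ha
    have h1 : ∀ᶠ p : ℕ × ℝ in atTop ×ˢ 𝓝[>] 0, m ≤ p.1 :=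
      tendsto_fst.eventually (eventually_ge_atTop m)
    have h2 : ∀ᶠ p : ℕ × ℝ in atTop ×ˢ 𝓝[>] 0, p.2 < δ :=
      tendsto_snd.eventually (eventually_nhdsWithin_of_eventually_nhds (eventually_lt_nhds hδ))
    filter_upwards [h1, h2] with p hp1 hp2
    exact (symRate_mono μ Ξ hp1 hp2.le).trans_lt h

/-- Approximating sequences exist. -/
theorem exists_isApproximating {R : ℝ} {n : ℕ} (ν : Fin n → Measure (Interval R))
    [∀ i, IsProbabilityMeasure (ν i)] :
    ∃ Ξ : (N : ℕ) → Fin n → Fin N → Interval R, IsApproximating ν Ξ := by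
  have key : ∀ i, ∃ ω : ℕ → Interval R, ∀ k : ℕ,
      Tendsto (fun N : ℕ => (N : ℝ)⁻¹ • ∑ j ∈ Finset.range N, (ω j : ℝ) ^ k) atTop
        (𝓝 (∫ x, (x : ℝ) ^ k ∂(ν i))) := by
    intro i
    let P : Measure (ℕ → Interval R) := Measure.infinitePi (fun _ => ν i)
    have hev : ∀ j : ℕ, P.map (fun ω => ω j) = ν i := fun j =>
      Measure.infinitePi_map_eval (fun _ : ℕ => ν i) j
    have hae : ∀ k : ℕ, ∀ᵐ ω ∂P,
        Tendsto (fun N : ℕ => (N : ℝ)⁻¹ • ∑ j ∈ Finset.range N, (ω j : ℝ) ^ k) atTop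
          (𝓝 (∫ x, (x : ℝ) ^ k ∂(ν i))) := by
      intro k
      have hg : Continuous (fun x : Interval R => (x : ℝ) ^ k) := by fun_prop
      have hind : ProbabilityTheory.iIndepFun
          (fun (j : ℕ) (ω : ℕ → Interval R) => (ω j : ℝ) ^ k) P :=
        ProbabilityTheory.iIndepFun_infinitePi (fun _ => hg.measurable)
      have hmeas : ∀ j : ℕ, Measurable (fun ω : ℕ → Interval R => ω j) := fun j =>
        measurable_pi_apply j
      have hint : ∫ x, (x : ℝ) ^ k ∂(ν i) = ∫ ω, ((ω 0 : Interval R) : ℝ) ^ k ∂P := by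
        rw [← hev 0, integral_map (hmeas 0).aemeasurable hg.aestronglyMeasurable]
      have hInt : Integrable (fun x : Interval R => (x : ℝ) ^ k) (ν i) :=
        hg.integrable_of_hasCompactSupport (HasCompactSupport.of_compactSpace _)
      rw [hint]
      refine ProbabilityTheory.strong_law_ae
        (fun (j : ℕ) (ω : ℕ → Interval R) => (ω j : ℝ) ^ k) ?_ ?_ ?_
      · rw [← hev 0] at hInt
        exact hInt.comp_measurable (hmeas 0)
      · exact fun a b hab => hind.indepFun hab
      · intro j
        have : ProbabilityTheory.IdentDistrib (fun ω : ℕ → Interval R => ω j)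
            (fun ω => ω 0) P P :=
          ⟨(hmeas j).aemeasurable, (hmeas 0).aemeasurable, by rw [hev, hev]⟩
        exact this.comp hg.measurable
    exact (ae_all_iff.2 hae).exists
  choose ω hω using key
  refine ⟨fun N i j => ω i (Tuple.sort (fun l : Fin N => ω i l) j), ⟨fun N i => ?_, fun i k => ?_⟩⟩
  · exact Tuple.monotone_sort (fun l : Fin N => ω i l)
  · refine (hω i k).congr fun N => ?_
    rw [kappa, one_div, smul_eq_mul,
      Equiv.sum_comp (Tuple.sort (fun l : Fin N => ω i l)) (fun l : Fin N => (ω i l : ℝ) ^ k),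
      ← Fin.sum_univ_eq_sum_range (fun j => (ω i j : ℝ) ^ k)]

end

end MutualPressure

/-!
Write `π` for the product of the marginals. The three quantities are compared in a cycle,
`klDiv μ π ≤ legendreISym μ Ξ ≤ ISym μ Ξ ≤ klDiv μ π`.

* Independent uniform shuffles of the rows of `Ξ N` have nearly the law of `N` independent samples
  of `π`, so the mutual pressure of `h` is at most `log ∫ exp h ∂π`; the Donsker-Varadhan
  variational formula gives the first inequality.
* On the shuffles whose mixed moments are close to those of `μ`, the empirical mean of `h` is close
  to `∫ h ∂μ`, by the Stone-Weierstrass theorem; bounding the exponential sum from below by these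
  shuffles gives the second.
* By the law of large numbers, most of the mass of `μ^N` lies on points whose mixed moments are
  close to those of `μ` and whose log-likelihood ratio with respect to `π^N` is close to
  `N * klDiv μ π`, so the `π^N`-mass of such points is at least about `exp (-N * klDiv μ π)`; this
  mass is then compared with the proportion of shuffles of `Ξ N` having these moments.

The entropy identity is the chain rule for the log-likelihood ratios of `μ ≪ π ≪ volume`.
-/

namespace MutualPressure

section DonskerVaradhan

open InformationTheory

/-- Truncation of `x` to `[exp (-M), exp M]`: for a density `f`, the bounded function
`log (clip M f)` replaces the optimal test function `log f` of the Donsker–Varadhan formula. -/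
noncomputable def clip (M x : ℝ) : ℝ := max (Real.exp (-M)) (min x (Real.exp M))

theorem clip_pos (M x : ℝ) : 0 < clip M x := lt_max_of_lt_left (Real.exp_pos _)

theorem measurable_clip (M : ℝ) : Measurable (clip M) := by
  unfold clip
  fun_prop

theorem clip_le_exp {M : ℝ} (hM : 0 ≤ M) (x : ℝ) : clip M x ≤ Real.exp M :=
  max_le (Real.exp_le_exp.2 (by linarith)) (min_le_right _ _)

theorem abs_log_clip_le {M : ℝ} (hM : 0 ≤ M) (x : ℝ) : |Real.log (clip M x)| ≤ M :=
  abs_le.2 ⟨(Real.le_log_iff_exp_le (clip_pos M x)).2 (le_max_left _ _),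
    (Real.log_le_iff_le_exp (clip_pos M x)).2 (clip_le_exp hM x)⟩

theorem sub_clip_mul_log_clip_nonneg {M : ℝ} (hM : 0 ≤ M) (x : ℝ) :
    0 ≤ (x - clip M x) * Real.log (clip M x) := by
  rcases le_total x (Real.exp (-M)) with h | h
  · have hc : clip M x = Real.exp (-M) := max_eq_left ((min_le_left _ _).trans h)
    rw [hc, Real.log_exp]
    exact mul_nonneg_of_nonpos_of_nonpos (sub_nonpos.2 h) (neg_nonpos.2 hM)
  rcases le_total x (Real.exp M) with h' | h'
  · have hc : clip M x = x := by rw [clip, min_eq_left h', max_eq_right h]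
    simp [hc]
  · have hc : clip M x = Real.exp M := by
      rw [clip, min_eq_right h', max_eq_right (Real.exp_le_exp.2 (by linarith))]
    rw [hc, Real.log_exp]
    exact mul_nonneg (sub_nonneg.2 h') hM

theorem mul_log_clip_add_one_sub_clip_nonneg {M : ℝ} (hM : 0 ≤ M) (x : ℝ) :
    0 ≤ x * Real.log (clip M x) + 1 - clip M x := by
  have h : 0 ≤ klFun (clip M x) := klFun_nonneg (clip_pos M x).le
  rw [klFun] at h
  linarith [sub_clip_mul_log_clip_nonneg hM x, sub_mul x (clip M x) (Real.log (clip M x))]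

theorem tendsto_clip {x : ℝ} (hx : 0 ≤ x) : Tendsto (fun M : ℕ => clip M x) atTop (𝓝 x) := by
  have hlow : Tendsto (fun M : ℕ => Real.exp (-M)) atTop (𝓝 0) :=
    Real.tendsto_exp_neg_atTop_nhds_zero.comp tendsto_natCast_atTop_atTop
  have hmin : Tendsto (fun M : ℕ => min x (Real.exp M)) atTop (𝓝 x) := by
    refine tendsto_const_nhds.congr' ?_
    filter_upwards [(Real.tendsto_exp_atTop.comp tendsto_natCast_atTop_atTop).eventually_ge_atTop x]
      with M hM using (min_eq_left hM).symm
  simpa only [clip, max_eq_right hx] using hlow.max hmin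

theorem tendsto_mul_log_clip_add_one_sub_clip {x : ℝ} (hx : 0 ≤ x) :
    Tendsto (fun M : ℕ => x * Real.log (clip M x) + 1 - clip M x) atTop (𝓝 (klFun x)) := by
  refine Tendsto.sub (Tendsto.add_const 1 ?_) (tendsto_clip hx)
  rcases hx.eq_or_lt with rfl | hx'
  · simp
  · exact ((tendsto_clip hx).log hx'.ne').const_mul x

variable {X : Type*} [MeasurableSpace X]

theorem integrable_of_abs_le {μ : Measure X} [IsFiniteMeasure μ] {f : X → ℝ} (hf : Measurable f)
    {M : ℝ} (hM : ∀ x, |f x| ≤ M) : Integrable f μ :=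
  Integrable.of_bound hf.aestronglyMeasurable M (ae_of_all _ hM)

theorem absolutelyContinuous_of_forall_bounded {μ π : Measure X} [IsFiniteMeasure μ]
    [IsProbabilityMeasure π] {C : ℝ}
    (h : ∀ (φ : X → ℝ) (M : ℝ), Measurable φ → (∀ x, |φ x| ≤ M) →
      ∫ x, φ x ∂μ - Real.log (∫ x, Real.exp (φ x) ∂π) ≤ C) :
    μ ≪ π := by
  refine Measure.AbsolutelyContinuous.mk fun s hs hπs => ?_
  by_contra hμs
  have hpos : 0 < μ.real s := ENNReal.toReal_pos hμs (measure_ne_top _ _)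
  obtain ⟨k, hk⟩ := exists_nat_gt (C / μ.real s)
  have hle := h (s.indicator fun _ => (k : ℝ)) k (measurable_const.indicator hs) fun x => by
    by_cases hx : x ∈ s <;> simp [hx]
  have hexp : ∫ x, Real.exp (s.indicator (fun _ => (k : ℝ)) x) ∂π = ∫ _, (1 : ℝ) ∂π := by
    refine integral_congr_ae ?_
    filter_upwards [measure_eq_zero_iff_ae_notMem.1 hπs] with x hx
    simp [hx]
  rw [hexp, integral_indicator_const _ hs] at hle
  simp only [integral_const, probReal_univ, smul_eq_mul, mul_one, Real.log_one, sub_zero] at hle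
  rw [div_lt_iff₀' hpos] at hk
  linarith

theorem integrable_rnDeriv_mul_log_clip {μ π : Measure X} [IsFiniteMeasure μ] {M : ℝ}
    (hM : 0 ≤ M) :
    Integrable (fun x => (μ.rnDeriv π x).toReal * Real.log (clip M (μ.rnDeriv π x).toReal)) π := by
  have hm : Measurable fun x => Real.log (clip M (μ.rnDeriv π x).toReal) :=
    ((measurable_clip M).comp (Measure.measurable_rnDeriv μ π).ennreal_toReal).log
  exact Measure.integrable_toReal_rnDeriv.mul_bdd hm.aestronglyMeasurable
    (ae_of_all _ fun x => abs_log_clip_le hM _)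

theorem integrable_clip_rnDeriv {μ π : Measure X} [IsFiniteMeasure π] {M : ℝ} (hM : 0 ≤ M) :
    Integrable (fun x => clip M (μ.rnDeriv π x).toReal) π :=
  integrable_of_abs_le
    ((measurable_clip M).comp (Measure.measurable_rnDeriv μ π).ennreal_toReal) fun x => by
      rw [abs_of_pos (clip_pos M _)]
      exact clip_le_exp hM _

variable {μ π : Measure X} [IsProbabilityMeasure μ] [IsProbabilityMeasure π]

theorem integral_mul_log_clip_le (hac : μ ≪ π) {C : ℝ}
    (h : ∀ (φ : X → ℝ) (M : ℝ), Measurable φ → (∀ x, |φ x| ≤ M) →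
      ∫ x, φ x ∂μ - Real.log (∫ x, Real.exp (φ x) ∂π) ≤ C) {M : ℝ} (hM : 0 ≤ M) :
    ∫ x, ((μ.rnDeriv π x).toReal * Real.log (clip M (μ.rnDeriv π x).toReal) + 1
      - clip M (μ.rnDeriv π x).toReal) ∂π ≤ C := by
  set f : X → ℝ := fun x => (μ.rnDeriv π x).toReal
  have hf : Measurable f := (Measure.measurable_rnDeriv μ π).ennreal_toReal
  have hclip : Integrable (fun x => clip M (f x)) π := integrable_clip_rnDeriv hM
  have hmul : Integrable (fun x => f x * Real.log (clip M (f x))) π :=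
    integrable_rnDeriv_mul_log_clip hM
  have hmul' : Integrable (fun x => f x * Real.log (clip M (f x)) + 1) π :=
    hmul.add (integrable_const 1)
  have hμ : ∫ x, f x * Real.log (clip M (f x)) ∂π = ∫ x, Real.log (clip M (f x)) ∂μ :=
    integral_rnDeriv_smul hac (f := fun x => Real.log (clip M (f x)))
  have htest := h (fun x => Real.log (clip M (f x))) M ((measurable_clip M).comp hf).log
    fun x => abs_log_clip_le hM _
  simp only [Real.exp_log (clip_pos M _)] at htest
  have hpos : 0 < ∫ x, clip M (f x) ∂π :=
    (Real.exp_pos (-M)).trans_le <| by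
      simpa using integral_mono (integrable_const (Real.exp (-M))) hclip fun x => le_max_left _ _
  calc ∫ x, (f x * Real.log (clip M (f x)) + 1 - clip M (f x)) ∂π
      = ∫ x, Real.log (clip M (f x)) ∂μ + 1 - ∫ x, clip M (f x) ∂π := by
        rw [integral_sub hmul' hclip, integral_add hmul (integrable_const 1), hμ]
        simp
    _ ≤ C := by linarith [Real.log_le_sub_one_of_pos hpos]

theorem klDiv_le_of_forall_bounded {C : ℝ}
    (h : ∀ (φ : X → ℝ) (M : ℝ), Measurable φ → (∀ x, |φ x| ≤ M) →
      ∫ x, φ x ∂μ - Real.log (∫ x, Real.exp (φ x) ∂π) ≤ C) :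
    klDiv μ π ≤ ENNReal.ofReal C := by
  have hac : μ ≪ π := absolutelyContinuous_of_forall_bounded h
  set f : X → ℝ := fun x => (μ.rnDeriv π x).toReal
  have hf : Measurable f := (Measure.measurable_rnDeriv μ π).ennreal_toReal
  let g : ℕ → X → ℝ := fun M x => f x * Real.log (clip M (f x)) + 1 - clip M (f x)
  have hg : ∀ M, Measurable (g M) := fun M =>
    ((hf.mul ((measurable_clip M).comp hf).log).add_const 1).sub ((measurable_clip M).comp hf)
  have hgi : ∀ M : ℕ, Integrable (g M) π := fun M =>
    ((integrable_rnDeriv_mul_log_clip M.cast_nonneg).add (integrable_const 1)).sub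
      (integrable_clip_rnDeriv M.cast_nonneg)
  have hlim : ∀ x, Tendsto (fun M => ENNReal.ofReal (g M x)) atTop
      (𝓝 (ENNReal.ofReal (klFun (f x)))) := fun x =>
    ENNReal.tendsto_ofReal (tendsto_mul_log_clip_add_one_sub_clip ENNReal.toReal_nonneg)
  have hbound : ∀ M, ∫⁻ x, ENNReal.ofReal (g M x) ∂π ≤ ENNReal.ofReal C := fun M => by
    rw [← ofReal_integral_eq_lintegral_ofReal (hgi M)
      (ae_of_all _ fun x => mul_log_clip_add_one_sub_clip_nonneg M.cast_nonneg _)]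
    exact ENNReal.ofReal_le_ofReal (integral_mul_log_clip_le hac h M.cast_nonneg)
  calc klDiv μ π = ∫⁻ x, ENNReal.ofReal (klFun (f x)) ∂π := klDiv_eq_lintegral_klFun_of_ac hac
    _ = ∫⁻ x, liminf (fun M => ENNReal.ofReal (g M x)) atTop ∂π :=
        lintegral_congr fun x => (hlim x).liminf_eq.symm
    _ ≤ liminf (fun M => ∫⁻ x, ENNReal.ofReal (g M x) ∂π) atTop :=
        lintegral_liminf_le fun M => (hg M).ennreal_ofReal
    _ ≤ ENNReal.ofReal C :=
        liminf_le_of_le (by isBoundedDefault) fun b hb =>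
          let ⟨M, hM⟩ := hb.exists
          hM.trans (hbound M)

theorem exists_seq_continuous_tendsto_ae [TopologicalSpace X] [NormalSpace X] [BorelSpace X]
    {ν : Measure X} [IsFiniteMeasure ν] [ν.WeaklyRegular] {f : X → ℝ} (hf : Measurable f) {M : ℝ}
    (hM : ∀ x, |f x| ≤ M) :
    ∃ g : ℕ → C(X, ℝ), (∀ k x, |g k x| ≤ M) ∧
      ∀ᵐ x ∂ν, Tendsto (fun k => g k x) atTop (𝓝 (f x)) := by
  have hfL : MemLp f 1 ν := memLp_one_iff_integrable.2 (integrable_of_abs_le hf hM)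
  have happrox : ∀ k : ℕ, ∃ u : BoundedContinuousFunction X ℝ,
      eLpNorm (f - ⇑u) 1 ν ≤ (k : ENNReal)⁻¹ := fun k =>
    let ⟨u, hu, _⟩ := hfL.exists_boundedContinuous_eLpNorm_sub_le ENNReal.one_ne_top
      (ENNReal.inv_ne_zero.2 (ENNReal.natCast_ne_top k))
    ⟨u, hu⟩
  choose u hu using happrox
  have hL1 : Tendsto (fun k => eLpNorm (⇑(u k) - f) 1 ν) atTop (𝓝 0) :=
    tendsto_of_tendsto_of_tendsto_of_le_of_le tendsto_const_nhds
      ENNReal.tendsto_inv_nat_nhds_zero (fun _ => zero_le) fun k => by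
        rw [eLpNorm_sub_comm]
        exact hu k
  obtain ⟨s, -, hs⟩ := (tendstoInMeasure_of_tendsto_eLpNorm one_ne_zero
    (fun k => (u k).continuous.aestronglyMeasurable) hf.aestronglyMeasurable
    hL1).exists_seq_tendsto_ae
  refine ⟨fun k => ⟨fun x => max (-M) (min (u (s k) x) M), by fun_prop⟩, fun k x => ?_, ?_⟩
  · have : 0 ≤ M := (abs_nonneg _).trans (hM x)
    exact abs_le.2 ⟨le_max_left _ _, max_le (by linarith) (min_le_right _ _)⟩
  · filter_upwards [hs] with x hx
    have hfx := abs_le.1 (hM x)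
    simpa only [ContinuousMap.coe_mk, min_eq_left hfx.2, max_eq_right hfx.1]
      using (tendsto_const_nhds (x := -M)).max (hx.min (tendsto_const_nhds (x := M)))

/-- The Donsker–Varadhan variational formula: continuous test functions already detect the
relative entropy. -/
theorem klDiv_le_of_forall_continuous [TopologicalSpace X] [NormalSpace X] [BorelSpace X]
    [(μ + π).WeaklyRegular] {C : ℝ}
    (h : ∀ φ : C(X, ℝ), ∫ x, φ x ∂μ - Real.log (∫ x, Real.exp (φ x) ∂π) ≤ C) :
    klDiv μ π ≤ ENNReal.ofReal C := by
  refine klDiv_le_of_forall_bounded fun φ M hφ hM => ?_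
  obtain ⟨g, hgM, hg⟩ := exists_seq_continuous_tendsto_ae (ν := μ + π) hφ hM
  obtain ⟨hgμ, hgπ⟩ := ae_add_measure_iff.1 hg
  have hint : Tendsto (fun k => ∫ x, g k x ∂μ) atTop (𝓝 (∫ x, φ x ∂μ)) :=
    tendsto_integral_of_dominated_convergence (fun _ => M)
      (fun k => (g k).continuous.aestronglyMeasurable) (integrable_const M)
      (fun k => ae_of_all _ (hgM k)) hgμ
  have hexp : Tendsto (fun k => ∫ x, Real.exp (g k x) ∂π) atTop (𝓝 (∫ x, Real.exp (φ x) ∂π)) := by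
    refine tendsto_integral_of_dominated_convergence (fun _ => Real.exp M)
      (fun k => by fun_prop) (integrable_const _)
      (fun k => ae_of_all _ fun x => ?_) (hgπ.mono fun x hx => hx.rexp)
    rw [Real.norm_of_nonneg (Real.exp_pos _).le]
    exact Real.exp_le_exp.2 ((le_abs_self _).trans (hgM k x))
  have hpos : 0 < ∫ x, Real.exp (φ x) ∂π := by
    refine integral_exp_pos (integrable_of_abs_le (M := Real.exp M) (by fun_prop) fun x => ?_)
    rw [abs_of_pos (Real.exp_pos _)]
    exact Real.exp_le_exp.2 ((le_abs_self _).trans (hM x))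
  exact le_of_tendsto' (hint.sub (hexp.log hpos.ne')) fun k => h (g k)

end DonskerVaradhan

section ProductMeasure

theorem lintegral_fin_prod_eq_prod {n : ℕ} {X : Fin n → Type*} [∀ i, MeasurableSpace (X i)]
    {μ : ∀ i, Measure (X i)} [∀ i, SigmaFinite (μ i)] {f : ∀ i, X i → ENNReal}
    (hf : ∀ i, Measurable (f i)) :
    ∫⁻ x, ∏ i, f i (x i) ∂Measure.pi μ = ∏ i, ∫⁻ x, f i x ∂μ i := by
  induction n with
  | zero => simp
  | succ n ih =>
    have hprod : Measurable fun x : ∀ i, X i => ∏ i, f i (x i) :=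
      Finset.measurable_fun_prod _ fun i _ => (hf i).comp (measurable_pi_apply i)
    have htail : Measurable fun x : ∀ i : Fin n, X i.succ => ∏ i, f i.succ (x i) :=
      Finset.measurable_fun_prod _ fun i _ => (hf i.succ).comp (measurable_pi_apply i)
    rw [← ((measurePreserving_piFinSuccAbove μ 0).symm).lintegral_comp hprod, Fin.prod_univ_succ,
      ← ih fun i => hf i.succ, ← lintegral_prod_mul (hf 0).aemeasurable htail.aemeasurable]
    refine lintegral_congr fun x => ?_
    rw [Fin.prod_univ_succ]
    rfl

variable {ι : Type*} [Fintype ι]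

theorem lintegral_fintype_prod_eq_prod {X : ι → Type*} [∀ i, MeasurableSpace (X i)]
    {μ : ∀ i, Measure (X i)} [∀ i, SigmaFinite (μ i)] {f : ∀ i, X i → ENNReal}
    (hf : ∀ i, Measurable (f i)) :
    ∫⁻ x, ∏ i, f i (x i) ∂Measure.pi μ = ∏ i, ∫⁻ x, f i x ∂μ i := by
  let e := (Fintype.equivFin ι).symm
  rw [← (measurePreserving_piCongrLeft μ e).lintegral_comp_emb
    (MeasurableEquiv.measurableEmbedding _)]
  simp_rw [← e.prod_comp, MeasurableEquiv.coe_piCongrLeft, Equiv.piCongrLeft_apply_apply]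
  exact lintegral_fin_prod_eq_prod fun i => hf (e i)

theorem pi_withDensity {X : ι → Type*} [∀ i, MeasurableSpace (X i)]
    {μ : ∀ i, Measure (X i)} [∀ i, SigmaFinite (μ i)] {f : ∀ i, X i → ENNReal}
    (hf : ∀ i, Measurable (f i)) [∀ i, SigmaFinite ((μ i).withDensity (f i))] :
    Measure.pi (fun i => (μ i).withDensity (f i)) =
      (Measure.pi μ).withDensity fun x => ∏ i, f i (x i) := by
  refine Measure.pi_eq fun s hs => ?_
  rw [withDensity_apply _ (MeasurableSet.univ_pi hs), Measure.restrict_pi_pi,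
    lintegral_fintype_prod_eq_prod hf]
  exact Finset.prod_congr rfl fun i _ => (withDensity_apply _ (hs i)).symm

theorem pi_le_exp_mul_pi_of_sum_llr_le {X : Type*} [MeasurableSpace X] {μ π : Measure X}
    [SigmaFinite μ] [SigmaFinite π] (hac : μ ≪ π) {E : Set (ι → X)} (hE : MeasurableSet E)
    {c : ℝ} (hc : ∀ y ∈ E, ∑ j, llr μ π (y j) ≤ c) :
    Measure.pi (fun _ => μ) E ≤ ENNReal.ofReal (Real.exp c) * Measure.pi (fun _ => π) E := by
  let f : X → ENNReal := fun x => ENNReal.ofReal (μ.rnDeriv π x).toReal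
  have hf : Measurable f := (Measure.measurable_rnDeriv μ π).ennreal_toReal.ennreal_ofReal
  have hμ : π.withDensity f = μ := by
    conv_rhs => rw [← Measure.withDensity_rnDeriv_eq μ π hac]
    exact withDensity_congr_ae ((Measure.rnDeriv_lt_top μ π).mono fun x hx =>
      ENNReal.ofReal_toReal hx.ne)
  have : SigmaFinite (π.withDensity f) := by rwa [hμ]
  have hpi := pi_withDensity (μ := fun _ : ι => π) (f := fun _ => f) fun _ => hf
  simp only [hμ] at hpi
  rw [hpi, withDensity_apply _ hE, ← setLIntegral_const]
  refine setLIntegral_mono measurable_const fun y hy => ?_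
  calc ∏ j, f (y j) ≤ ∏ j, ENNReal.ofReal (Real.exp (llr μ π (y j))) :=
        Finset.prod_le_prod' fun j _ => ENNReal.ofReal_le_ofReal (Real.le_exp_log _)
    _ = ENNReal.ofReal (Real.exp (∑ j, llr μ π (y j))) := by
        rw [Real.exp_sum, ENNReal.ofReal_prod_of_nonneg fun j _ => (Real.exp_pos _).le]
    _ ≤ ENNReal.ofReal (Real.exp c) := ENNReal.ofReal_le_ofReal (Real.exp_le_exp.2 (hc y hy))

end ProductMeasure

section Shuffle

variable {ι κ X : Type*}

/-- The action of `S_ι^κ` on configurations `y : ι → κ → X`, the `i`-th permutation acting on the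
`i`-th column. A configuration lists `ι`-many points of `X^κ`, so it is the transpose of the tuples
on which `permute` acts. -/
def shuffle (σ : κ → Equiv.Perm ι) (y : ι → κ → X) : ι → κ → X := fun j i => y ((σ i)⁻¹ j) i

theorem shuffle_shuffle (σ τ : κ → Equiv.Perm ι) (y : ι → κ → X) :
    shuffle σ (shuffle τ y) = shuffle (σ * τ) y := by
  ext j i
  simp [shuffle]

theorem sum_shuffle_shuffle [Fintype ι] [Fintype κ] [DecidableEq ι] [DecidableEq κ]
    {M : Type*} [AddCommMonoid M] (F : (ι → κ → X) → M) (τ : κ → Equiv.Perm ι) (y : ι → κ → X) :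
    ∑ σ : κ → Equiv.Perm ι, F (shuffle σ (shuffle τ y)) =
      ∑ σ : κ → Equiv.Perm ι, F (shuffle σ y) := by
  simp_rw [shuffle_shuffle]
  exact Equiv.sum_comp (Equiv.mulRight τ) fun σ => F (shuffle σ y)

variable [MeasurableSpace X]

theorem measurable_shuffle (σ : κ → Equiv.Perm ι) :
    Measurable (shuffle σ : (ι → κ → X) → ι → κ → X) := by
  unfold shuffle
  fun_prop

variable [Fintype ι] [Fintype κ] (ν : κ → Measure X) [∀ i, IsProbabilityMeasure (ν i)]

theorem measurePreserving_curry :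
    MeasurePreserving (MeasurableEquiv.curry ι κ X) (Measure.pi fun p : ι × κ => ν p.2)
      (Measure.pi fun _ : ι => Measure.pi ν) :=
  ⟨MeasurableEquiv.measurable _, by
    simpa only [Measure.infinitePi_eq_pi] using
      Measure.infinitePi_map_curry fun (_ : ι) (i : κ) => ν i⟩

theorem measurePreserving_shuffle (σ : κ → Equiv.Perm ι) :
    MeasurePreserving (shuffle σ) (Measure.pi fun _ : ι => Measure.pi ν)
      (Measure.pi fun _ : ι => Measure.pi ν) := by
  let e : ι × κ ≃ ι × κ := (Equiv.prodComm ι κ).trans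
    ((Equiv.prodShear (Equiv.refl κ) σ).trans (Equiv.prodComm κ ι))
  have he : MeasurePreserving (MeasurableEquiv.arrowCongr' e (MeasurableEquiv.refl X))
      (Measure.pi fun p : ι × κ => ν p.2) (Measure.pi fun p : ι × κ => ν p.2) :=
    measurePreserving_arrowCongr' (fun p => ν p.2) (fun p => ν p.2) e _ fun p => .id (ν p.2)
  have hcurry := measurePreserving_curry (ι := ι) ν
  exact hcurry.comp (he.comp hcurry.symm)

variable [DecidableEq ι] [DecidableEq κ]

theorem lintegral_sum_shuffle {F : (ι → κ → X) → ENNReal} (hF : Measurable F) :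
    ∫⁻ y, ∑ σ : κ → Equiv.Perm ι, F (shuffle σ y) ∂Measure.pi (fun _ : ι => Measure.pi ν) =
      Fintype.card (κ → Equiv.Perm ι) * ∫⁻ y, F y ∂Measure.pi (fun _ : ι => Measure.pi ν) := by
  have hm : ∀ σ : κ → Equiv.Perm ι, Measurable fun y => F (shuffle σ y) := fun σ =>
    hF.comp (measurable_shuffle σ)
  rw [lintegral_finsetSum _ fun σ _ => hm σ]
  simp_rw [(measurePreserving_shuffle ν _).lintegral_comp hF]
  simp

theorem sum_mul_measure_le_lintegral {F : (ι → κ → X) → ENNReal} (hF : Measurable F)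
    {G : Set (ι → κ → X)} {c : (κ → Equiv.Perm ι) → ENNReal}
    (h : ∀ y ∈ G, ∃ τ, ∀ σ, c σ ≤ F (shuffle σ (shuffle τ y))) :
    (∑ σ, c σ) * Measure.pi (fun _ : ι => Measure.pi ν) G ≤
      Fintype.card (κ → Equiv.Perm ι) * ∫⁻ y, F y ∂Measure.pi (fun _ : ι => Measure.pi ν) := by
  rw [← lintegral_sum_shuffle ν hF, ← setLIntegral_const]
  refine (setLIntegral_mono ?_ fun y hy => ?_).trans (setLIntegral_le_lintegral G _)
  · exact Finset.measurable_fun_sum _ fun σ _ => hF.comp (measurable_shuffle σ)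
  · obtain ⟨τ, hτ⟩ := h y hy
    rw [← sum_shuffle_shuffle F τ]
    exact Finset.sum_le_sum fun σ _ => hτ σ

theorem lintegral_le_sum {F : (ι → κ → X) → ENNReal} (hF : Measurable F)
    {c : (κ → Equiv.Perm ι) → ENNReal} (h : ∀ y, ∃ τ, ∀ σ, F (shuffle σ (shuffle τ y)) ≤ c σ) :
    Fintype.card (κ → Equiv.Perm ι) * ∫⁻ y, F y ∂Measure.pi (fun _ : ι => Measure.pi ν) ≤
      ∑ σ, c σ := by
  have hle : ∀ y, ∑ σ, F (shuffle σ y) ≤ ∑ σ, c σ := fun y => by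
    obtain ⟨τ, hτ⟩ := h y
    rw [← sum_shuffle_shuffle F τ]
    exact Finset.sum_le_sum fun σ _ => hτ σ
  rw [← lintegral_sum_shuffle ν hF]
  exact (lintegral_mono hle).trans_eq (by simp)

end Shuffle

section Kappa

variable {N : ℕ}

theorem kappa_mono {x y : Fin N → ℝ} (h : ∀ j, x j ≤ y j) : kappa x ≤ kappa y :=
  mul_le_mul_of_nonneg_left (Finset.sum_le_sum fun j _ => h j) (by positivity)

theorem kappa_add (x y : Fin N → ℝ) : kappa (fun j => x j + y j) = kappa x + kappa y := by
  simp [kappa, Finset.sum_add_distrib, mul_add]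

theorem kappa_sub (x y : Fin N → ℝ) : kappa (fun j => x j - y j) = kappa x - kappa y := by
  simp [kappa, Finset.sum_sub_distrib, mul_sub]

theorem kappa_const_mul (c : ℝ) (x : Fin N → ℝ) : kappa (fun j => c * x j) = c * kappa x := by
  simp only [kappa, ← Finset.mul_sum, mul_left_comm]

theorem kappa_sum {ι : Type*} (s : Finset ι) (x : ι → Fin N → ℝ) :
    kappa (fun j => ∑ i ∈ s, x i j) = ∑ i ∈ s, kappa (x i) := by
  simp only [kappa, ← Finset.mul_sum]
  rw [Finset.sum_comm]

theorem kappa_const (hN : 0 < N) (c : ℝ) : kappa (fun _ : Fin N => c) = c := by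
  have : (N : ℝ) ≠ 0 := by positivity
  simp [kappa, this]

theorem kappa_const_le {c : ℝ} (hc : 0 ≤ c) : kappa (fun _ : Fin N => c) ≤ c := by
  rcases N.eq_zero_or_pos with rfl | hN
  · simpa [kappa] using hc
  · exact (kappa_const hN c).le

theorem kappa_nonneg {x : Fin N → ℝ} (h : ∀ j, 0 ≤ x j) : 0 ≤ kappa x :=
  mul_nonneg (by positivity) (Finset.sum_nonneg fun j _ => h j)

theorem kappa_comp_perm (σ : Equiv.Perm (Fin N)) (x : Fin N → ℝ) :
    kappa (fun j => x (σ j)) = kappa x := by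
  simp only [kappa, Equiv.sum_comp σ x]

theorem natCast_mul_kappa (x : Fin N → ℝ) : (N : ℝ) * kappa x = ∑ j, x j := by
  rcases N.eq_zero_or_pos with rfl | hN
  · simp [kappa]
  · have : (N : ℝ) ≠ 0 := by positivity
    rw [kappa, ← mul_assoc, mul_one_div_cancel this, one_mul]

theorem abs_kappa_le (x : Fin N → ℝ) : |kappa x| ≤ kappa fun j => |x j| := by
  rw [kappa, kappa, abs_mul, abs_of_nonneg (by positivity : (0 : ℝ) ≤ 1 / N)]
  exact mul_le_mul_of_nonneg_left (Finset.abs_sum_le_sum_abs _ _) (by positivity)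

end Kappa

section StoneWeierstrass

variable {X : Type*} [TopologicalSpace X]

/-- The mean of a function along a finite sequence, as a linear functional. -/
noncomputable def kappaLinear {N : ℕ} (x : Fin N → X) : C(X, ℝ) →ₗ[ℝ] ℝ where
  toFun f := kappa fun j => f (x j)
  map_add' _ _ := kappa_add _ _
  map_smul' c _ := kappa_const_mul c _

variable [CompactSpace X]

theorem abs_kappaLinear_le {N : ℕ} (x : Fin N → X) (f : C(X, ℝ)) : |kappaLinear x f| ≤ ‖f‖ :=
  (abs_kappa_le _).trans ((kappa_mono fun j => f.norm_coe_le_norm (x j)).trans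
    (kappa_const_le (norm_nonneg _)))

theorem integrable_continuousMap [MeasurableSpace X] [BorelSpace X] (μ : Measure X)
    [IsFiniteMeasure μ] (f : C(X, ℝ)) : Integrable f μ :=
  integrable_of_abs_le f.continuous.measurable f.norm_coe_le_norm

/-- Integration against a finite measure, as a linear functional on continuous functions. -/
noncomputable def integralLinear [MeasurableSpace X] [BorelSpace X] (μ : Measure X)
    [IsFiniteMeasure μ] : C(X, ℝ) →ₗ[ℝ] ℝ where
  toFun f := ∫ x, f x ∂μ
  map_add' f g := integral_add (integrable_continuousMap μ f) (integrable_continuousMap μ g)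
  map_smul' c _ := integral_const_mul c _

theorem abs_integralLinear_le [MeasurableSpace X] [BorelSpace X] (μ : Measure X)
    [IsProbabilityMeasure μ] (f : C(X, ℝ)) : |integralLinear μ f| ≤ ‖f‖ := by
  simpa [integralLinear] using norm_integral_le_of_norm_le_const (μ := μ)
    (ae_of_all _ f.norm_coe_le_norm)

theorem tendsto_of_mem_closure {E ι : Type*} [SeminormedAddCommGroup E] [Module ℝ E]
    {l : Filter ι} {Λ : ι → E →ₗ[ℝ] ℝ} {Λ₀ : E →ₗ[ℝ] ℝ} (hΛ : ∀ a f, |Λ a f| ≤ ‖f‖)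
    (hΛ₀ : ∀ f, |Λ₀ f| ≤ ‖f‖) {S : Set E} (hS : ∀ g ∈ S, Tendsto (fun a => Λ a g) l (𝓝 (Λ₀ g)))
    {f : E} (hf : f ∈ closure S) : Tendsto (fun a => Λ a f) l (𝓝 (Λ₀ f)) := by
  rw [Metric.tendsto_nhds]
  intro ε hε
  obtain ⟨g, hg, hfg⟩ := Metric.mem_closure_iff.1 hf (ε / 3) (by positivity)
  rw [dist_eq_norm] at hfg
  filter_upwards [Metric.tendsto_nhds.1 (hS g hg) (ε / 3) (by positivity)] with a ha
  have hΛfg : |Λ a f - Λ a g| < ε / 3 := by simpa only [map_sub] using (hΛ a (f - g)).trans_lt hfg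
  have hΛ₀fg : |Λ₀ f - Λ₀ g| < ε / 3 := by simpa only [map_sub] using (hΛ₀ (f - g)).trans_lt hfg
  rw [Real.dist_eq] at ha ⊢
  rw [abs_lt] at *
  constructor <;> linarith [hΛfg.1, hΛfg.2, hΛ₀fg.1, hΛ₀fg.2, ha.1, ha.2]

theorem tendsto_of_tendsto_monomials {ι : Type*} {l : Filter ι} {Λ : ι → C(X, ℝ) →ₗ[ℝ] ℝ}
    {Λ₀ : C(X, ℝ) →ₗ[ℝ] ℝ} (hΛ : ∀ a f, |Λ a f| ≤ ‖f‖) (hΛ₀ : ∀ f, |Λ₀ f| ≤ ‖f‖)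
    {S : Set C(X, ℝ)} (hsep : (Algebra.adjoin ℝ S).SeparatesPoints)
    (hS : ∀ f ∈ Submonoid.closure S, Tendsto (fun a => Λ a f) l (𝓝 (Λ₀ f))) (f : C(X, ℝ)) :
    Tendsto (fun a => Λ a f) l (𝓝 (Λ₀ f)) := by
  have hadj : ∀ g ∈ (Algebra.adjoin ℝ S : Set C(X, ℝ)),
      Tendsto (fun a => Λ a g) l (𝓝 (Λ₀ g)) := by
    intro g hg
    rw [SetLike.mem_coe, ← Subalgebra.mem_toSubmodule, Algebra.adjoin_eq_span] at hg
    induction hg using Submodule.span_induction with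
    | mem x hx => exact hS x hx
    | zero => simpa using tendsto_const_nhds
    | add x y _ _ hx hy => simpa using hx.add hy
    | smul c x _ hx => simpa using hx.const_mul c
  refine tendsto_of_mem_closure hΛ hΛ₀ hadj ?_
  rw [← Subalgebra.topologicalClosure_coe,
    ContinuousMap.subalgebra_topologicalClosure_eq_top_of_separatesPoints _ hsep]
  trivial

end StoneWeierstrass

section Rearrangement

/-- For two sorted sequences all crossings of `[t, s]` go in the same direction, so they cannot
cancel in the difference of the means of `f`. -/
theorem kappa_crossing_le {N : ℕ} {a b : Fin N → ℝ} (ha : Monotone a) (hb : Monotone b)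
    {t s : ℝ} (hts : t ≤ s) {f : ℝ → ℝ} (hf : ∀ x, f x ∈ Set.Icc 0 1) (hf1 : ∀ x ≤ t, f x = 1)
    (hf0 : ∀ x, s ≤ x → f x = 0) :
    kappa ({j | min (a j) (b j) ≤ t ∧ s < max (a j) (b j)}.indicator 1) ≤
      |kappa (fun j => f (a j)) - kappa (fun j => f (b j))| := by
  by_cases! hex : ∃ j, min (a j) (b j) ≤ t ∧ s < max (a j) (b j)
  · obtain ⟨j₀, hmin, hmax⟩ := hex
    wlog hab : a j₀ ≤ b j₀ generalizing a b
    · rw [abs_sub_comm]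
      simp only [min_comm (a _), max_comm (a _)] at hmin hmax ⊢
      exact this hb ha hmin hmax (le_of_not_ge hab)
    rw [min_eq_left hab] at hmin
    rw [max_eq_right hab] at hmax
    refine le_trans ?_ (le_abs_self _)
    rw [← kappa_sub]
    refine kappa_mono fun j => ?_
    rcases le_or_gt (b j) s with hj | hj
    · have hja : a j ≤ t := (ha (hb.reflect_lt (hj.trans_lt hmax)).le).trans hmin
      rw [Set.indicator_of_notMem fun h => absurd h.2 (max_le (hja.trans hts) hj).not_gt,
        hf1 _ hja]
      exact sub_nonneg.2 (hf _).2
    · rw [hf0 _ hj.le, sub_zero]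
      refine Set.indicator_apply_le' (fun h => ?_) fun _ => (hf _).1
      rw [hf1 _ ((min_le_iff.1 h.1).resolve_right (hts.trans_lt hj).not_ge), Pi.one_apply]
  · have hempty : {j | min (a j) (b j) ≤ t ∧ s < max (a j) (b j)} = ∅ :=
      Set.eq_empty_of_forall_notMem fun j hj => (hex j hj.1).not_gt hj.2
    rw [hempty, Set.indicator_empty]
    exact (kappa_const_le le_rfl).trans (abs_nonneg _)

theorem abs_sub_le_sum_crossing {p q δ x y : ℝ} (hδ : 0 < δ) (hx : x ∈ Set.Icc p q)
    (hy : y ∈ Set.Icc p q) :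
    |x - y| ≤ 2 * δ + (q - p) * ∑ k ∈ Finset.range (⌈(q - p) / δ⌉₊ + 1),
      {u : ℝ × ℝ | min u.1 u.2 ≤ p + k * δ ∧ p + k * δ + δ < max u.1 u.2}.indicator 1 (x, y) := by
  wlog hxy : x ≤ y generalizing x y
  · rw [abs_sub_comm]
    simpa only [Set.indicator, Set.mem_ofPred_eq, Pi.one_apply, min_comm x, max_comm x]
      using this hy hx (le_of_not_ge hxy)
  set A : ℕ → Set (ℝ × ℝ) := fun k =>
    {u | min u.1 u.2 ≤ p + k * δ ∧ p + k * δ + δ < max u.1 u.2}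
  have hpq : 0 ≤ q - p := sub_nonneg.2 (hx.1.trans hx.2)
  have hnonneg : ∀ k, 0 ≤ (A k).indicator (1 : ℝ × ℝ → ℝ) (x, y) := fun k =>
    Set.indicator_nonneg (fun _ _ => zero_le_one) _
  rw [abs_sub_comm, abs_of_nonneg (sub_nonneg.2 hxy)]
  rcases le_or_gt (y - x) (2 * δ) with h | h
  · exact h.trans (le_add_of_nonneg_right (mul_nonneg hpq (Finset.sum_nonneg fun k _ => hnonneg k)))
  · let k := ⌈(x - p) / δ⌉₊
    have hk : x - p ≤ k * δ := (div_le_iff₀ hδ).1 (Nat.le_ceil _)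
    have hk' : k * δ < x - p + δ := by
      have := Nat.ceil_lt_add_one (div_nonneg (sub_nonneg.2 hx.1) hδ.le)
      rwa [div_add_one hδ.ne', lt_div_iff₀ hδ] at this
    have hkmem : k ∈ Finset.range (⌈(q - p) / δ⌉₊ + 1) :=
      Finset.mem_range.2 (Nat.lt_succ_of_le (Nat.ceil_mono (by gcongr; exact hx.2)))
    have hkA : (x, y) ∈ A k := by
      simp only [A, Set.mem_ofPred_eq, min_eq_left hxy, max_eq_right hxy]
      constructor <;> linarith
    have hone : (1 : ℝ) ≤ ∑ k ∈ Finset.range (⌈(q - p) / δ⌉₊ + 1),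
        (A k).indicator (1 : ℝ × ℝ → ℝ) (x, y) := by
      simpa only [Set.indicator_of_mem hkA, Pi.one_apply]
        using Finset.single_le_sum (fun k _ => hnonneg k) hkmem
    nlinarith [hx.1, hy.2, mul_le_mul_of_nonneg_left hone hpq]

theorem exists_kappa_abs_sub_le (p q : ℝ) {δ : ℝ} (hδ : 0 < δ) :
    ∃ (K : ℕ) (f : ℕ → C(ℝ, ℝ)), ∀ {N : ℕ} {a b : Fin N → ℝ}, Monotone a → Monotone b →
      (∀ j, a j ∈ Set.Icc p q) → (∀ j, b j ∈ Set.Icc p q) →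
      kappa (fun j => |a j - b j|) ≤ 2 * δ + (q - p) * ∑ k ∈ Finset.range K,
        |kappa (fun j => f k (a j)) - kappa (fun j => f k (b j))| := by
  have hurysohn : ∀ k : ℕ, ∃ f : C(ℝ, ℝ), (∀ x, p + k * δ + δ ≤ x → f x = 0) ∧
      (∀ x ≤ p + k * δ, f x = 1) ∧ ∀ x, f x ∈ Set.Icc (0 : ℝ) 1 := fun k =>
    exists_continuous_zero_one_of_isClosed isClosed_Ici isClosed_Iic
      (Set.Iic_disjoint_Ici.2 (by linarith)).symm
  choose f hf0 hf1 hf using hurysohn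
  refine ⟨⌈(q - p) / δ⌉₊ + 1, f, fun {N a b} ha hb hapq hbpq => ?_⟩
  rcases N.eq_zero_or_pos with rfl | hN
  · simpa [kappa] using hδ.le
  have hpq : 0 ≤ q - p := sub_nonneg.2 ((hapq ⟨0, hN⟩).1.trans (hapq ⟨0, hN⟩).2)
  refine (kappa_mono fun j => abs_sub_le_sum_crossing hδ (hapq j) (hbpq j)).trans ?_
  rw [kappa_add, kappa_const hN, kappa_const_mul, kappa_sum]
  gcongr with k
  exact kappa_crossing_le ha hb (by linarith) (hf k) (hf1 k) (hf0 k)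

theorem tendsto_kappa_abs_sub {p q : ℝ} {a b : (N : ℕ) → Fin N → ℝ} (ha : ∀ N, Monotone (a N))
    (hb : ∀ N, Monotone (b N)) (hapq : ∀ N j, a N j ∈ Set.Icc p q)
    (hbpq : ∀ N j, b N j ∈ Set.Icc p q)
    (hab : ∀ f : C(ℝ, ℝ), Tendsto
      (fun N => kappa (fun j => f (a N j)) - kappa (fun j => f (b N j))) atTop (𝓝 0)) :
    Tendsto (fun N => kappa fun j => |a N j - b N j|) atTop (𝓝 0) := by
  refine tendsto_order.2 ⟨fun ε hε => Eventually.of_forall fun N =>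
    hε.trans_le (kappa_nonneg fun j => abs_nonneg _), fun ε hε => ?_⟩
  obtain ⟨K, f, hf⟩ := exists_kappa_abs_sub_le p q (δ := ε / 4) (by positivity)
  have hlim : Tendsto (fun N => 2 * (ε / 4) + (q - p) * ∑ k ∈ Finset.range K,
      |kappa (fun j => f k (a N j)) - kappa (fun j => f k (b N j))|) atTop
      (𝓝 (2 * (ε / 4) + (q - p) * ∑ _ ∈ Finset.range K, |(0 : ℝ)|)) :=
    ((tendsto_finsetSum _ fun k _ => (hab (f k)).abs).const_mul _).const_add _
  filter_upwards [hlim.eventually_lt_const (u := ε) (by simp; linarith)] with N hN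
  exact (hf (ha N) (hb N) (hapq N) (hbpq N)).trans_lt hN

end Rearrangement

section Approximating

variable {R : ℝ}

/-- The inclusion `[-R, R] → ℝ` as a continuous function. -/
def coordinate (R : ℝ) : C(Interval R, ℝ) := ⟨Subtype.val, continuous_subtype_val⟩

theorem tendsto_kappa_of_tendsto_moment {ν : Measure (Interval R)} [IsProbabilityMeasure ν]
    {a : (N : ℕ) → Fin N → Interval R}
    (h : ∀ k : ℕ, Tendsto (fun N => kappa fun j => (a N j : ℝ) ^ k) atTop
      (𝓝 (∫ x, (x : ℝ) ^ k ∂ν))) (f : C(Interval R, ℝ)) :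
    Tendsto (fun N => kappa fun j => f (a N j)) atTop (𝓝 (∫ x, f x ∂ν)) := by
  refine tendsto_of_tendsto_monomials (Λ := fun N => kappaLinear (a N)) (Λ₀ := integralLinear ν)
    (fun N f => abs_kappaLinear_le _ f) (abs_integralLinear_le ν) (S := {coordinate R}) ?_ ?_ f
  · exact fun x y hxy => ⟨coordinate R, ⟨coordinate R, Algebra.subset_adjoin rfl, rfl⟩,
      fun h => hxy (Subtype.ext h)⟩
  · intro g hg
    obtain ⟨k, rfl⟩ := Submonoid.mem_closure_singleton.1 hg
    exact h k

theorem tendsto_kappa_dist_of_tendsto_moment {ν : Measure (Interval R)} [IsProbabilityMeasure ν]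
    {a b : (N : ℕ) → Fin N → Interval R} (ha : ∀ N, Monotone (a N)) (hb : ∀ N, Monotone (b N))
    (hma : ∀ k : ℕ, Tendsto (fun N => kappa fun j => (a N j : ℝ) ^ k) atTop
      (𝓝 (∫ x, (x : ℝ) ^ k ∂ν)))
    (hmb : ∀ k : ℕ, Tendsto (fun N => kappa fun j => (b N j : ℝ) ^ k) atTop
      (𝓝 (∫ x, (x : ℝ) ^ k ∂ν))) :
    Tendsto (fun N => kappa fun j => dist (a N j) (b N j)) atTop (𝓝 0) := by
  refine tendsto_kappa_abs_sub (a := fun N j => a N j) (b := fun N j => b N j) ha hb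
    (fun N j => (a N j).2) (fun N j => (b N j).2) fun f => ?_
  have hf := (tendsto_kappa_of_tendsto_moment hma (f.comp (coordinate R))).sub
    (tendsto_kappa_of_tendsto_moment hmb (f.comp (coordinate R)))
  rwa [sub_self] at hf

end Approximating

section MeanDist

variable {N : ℕ} {κ X : Type*} [Fintype κ] [PseudoMetricSpace X]

/-- The `ℓ¹` distance between two `N`-tuples of points of `X^κ`, averaged over the `N` points. -/
noncomputable def meanDist (x y : Fin N → κ → X) : ℝ := kappa fun j => ∑ i, dist (x j i) (y j i)

theorem meanDist_shuffle (σ : κ → Equiv.Perm (Fin N)) (x y : Fin N → κ → X) :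
    meanDist (shuffle σ x) (shuffle σ y) = meanDist x y := by
  simp only [meanDist, kappa_sum]
  exact Finset.sum_congr rfl fun i _ => kappa_comp_perm (σ i)⁻¹ fun j => dist (x j i) (y j i)

theorem exists_abs_sub_le_add_mul_sum_dist [CompactSpace X] (h : C(κ → X, ℝ)) {ε : ℝ}
    (hε : 0 < ε) :
    ∃ K : ℝ, 0 ≤ K ∧ ∀ x y : κ → X, |h x - h y| ≤ ε + K * ∑ i, dist (x i) (y i) := by
  have huc : UniformContinuous h := CompactSpace.uniformContinuous_of_continuous h.continuous
  obtain ⟨δ, hδ, hdist⟩ := Metric.uniformContinuous_iff.1 huc ε hε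
  refine ⟨2 * ‖h‖ / δ, by positivity, fun x y => ?_⟩
  have hsum : 0 ≤ ∑ i, dist (x i) (y i) := Finset.sum_nonneg fun i _ => dist_nonneg
  rcases lt_or_ge (∑ i, dist (x i) (y i)) δ with hlt | hge
  · have hxy : dist x y < δ := ((dist_pi_le_iff hsum).2 fun i =>
      Finset.single_le_sum (f := fun i => dist (x i) (y i)) (fun _ _ => dist_nonneg)
        (Finset.mem_univ i)).trans_lt hlt
    exact (hdist hxy).le.trans (le_add_of_nonneg_right (by positivity))
  · calc |h x - h y| ≤ 2 * ‖h‖ := h.dist_le_two_norm x y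
      _ = 2 * ‖h‖ / δ * δ := (div_mul_cancel₀ _ hδ.ne').symm
      _ ≤ 2 * ‖h‖ / δ * ∑ i, dist (x i) (y i) := by gcongr
      _ ≤ _ := le_add_of_nonneg_left hε.le

theorem exists_abs_kappa_sub_le_of_meanDist_lt [CompactSpace X] (h : C(κ → X, ℝ)) {ε : ℝ}
    (hε : 0 < ε) :
    ∃ η : ℝ, 0 < η ∧ ∀ (N : ℕ) (x y : Fin N → κ → X), meanDist x y < η →
      |kappa (fun j => h (x j)) - kappa (fun j => h (y j))| ≤ ε := by
  obtain ⟨K, hK, hh⟩ := exists_abs_sub_le_add_mul_sum_dist h (half_pos hε)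
  refine ⟨ε / 2 / (K + 1), by positivity, fun N x y hxy => ?_⟩
  have hKη : K * meanDist x y ≤ ε / 2 := by
    rw [lt_div_iff₀ (by positivity)] at hxy
    have : 0 ≤ meanDist x y := kappa_nonneg fun j => Finset.sum_nonneg fun i _ => dist_nonneg
    linarith
  calc |kappa (fun j => h (x j)) - kappa (fun j => h (y j))|
      ≤ kappa fun j => |h (x j) - h (y j)| := by
        rw [← kappa_sub]
        exact abs_kappa_le _
    _ ≤ kappa fun j => ε / 2 + K * ∑ i, dist (x j i) (y j i) := kappa_mono fun j => hh _ _
    _ = kappa (fun _ : Fin N => ε / 2) + K * meanDist x y := by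
        rw [kappa_add, kappa_const_mul, meanDist]
    _ ≤ ε / 2 + ε / 2 := add_le_add (kappa_const_le (half_pos hε).le) hKη
    _ = ε := add_halves ε

/-- Configurations which, after permuting their columns, are `η`-close in mean to `ξ`. -/
def nearShuffles (ξ : Fin N → κ → X) (η : ℝ) : Set (Fin N → κ → X) :=
  {y | ∃ τ : κ → Equiv.Perm (Fin N), meanDist (shuffle τ y) ξ < η}

theorem isOpen_nearShuffles (ξ : Fin N → κ → X) (η : ℝ) : IsOpen (nearShuffles ξ η) := by
  simp only [nearShuffles, Set.ofPred_exists]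
  refine isOpen_iUnion fun τ => isOpen_lt ?_ continuous_const
  unfold meanDist kappa shuffle
  fun_prop

theorem shuffle_mem_nearShuffles_iff {ξ : Fin N → κ → X} {η : ℝ} (σ : κ → Equiv.Perm (Fin N))
    {y : Fin N → κ → X} : shuffle σ y ∈ nearShuffles ξ η ↔ y ∈ nearShuffles ξ η := by
  simp only [nearShuffles, Set.mem_ofPred_eq, shuffle_shuffle]
  exact (Equiv.mulRight σ).exists_congr_left.trans (by simp)

end MeanDist

section LawOfLargeNumbers

variable {X : Type*} [MeasurableSpace X] (μ : Measure X) [IsProbabilityMeasure μ]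

theorem map_infinitePi_initial (N : ℕ) :
    (Measure.infinitePi fun _ : ℕ => μ).map (fun ω (j : Fin N) => ω j) =
      Measure.pi fun _ : Fin N => μ := by
  have hindep : ProbabilityTheory.iIndepFun (fun (j : Fin N) (ω : ℕ → X) => ω j)
      (Measure.infinitePi fun _ : ℕ => μ) :=
    (ProbabilityTheory.iIndepFun_infinitePi (P := fun _ : ℕ => μ) (X := fun _ => (id : X → X))
      fun _ => measurable_id).precomp Fin.val_injective
  rw [hindep.map_fun_eq_pi_map fun j : Fin N => (measurable_pi_apply (j : ℕ)).aemeasurable]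
  exact congrArg Measure.pi
    (funext fun j => Measure.infinitePi_map_eval (fun _ : ℕ => μ) (j : ℕ))

theorem tendsto_pi_of_ae_eventually_mem {A : (N : ℕ) → Set (Fin N → X)}
    (hA : ∀ N, MeasurableSet (A N))
    (h : ∀ᵐ ω ∂(Measure.infinitePi fun _ : ℕ => μ), ∀ᶠ N in atTop,
      (fun j : Fin N => ω j) ∈ A N) :
    Tendsto (fun N => Measure.pi (fun _ : Fin N => μ) (A N)) atTop (𝓝 1) := by
  have hm : ∀ N : ℕ, Measurable fun (ω : ℕ → X) (j : Fin N) => ω j := fun N => by fun_prop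
  have hlim := tendsto_measure_of_ae_tendsto_indicator_of_isFiniteMeasure atTop
    (μ := Measure.infinitePi fun _ : ℕ => μ) (A := Set.univ)
    (As := fun N => (fun (ω : ℕ → X) (j : Fin N) => ω j) ⁻¹' A N) MeasurableSet.univ
    (fun N => hm N (hA N)) (by simpa using h)
  rw [measure_univ] at hlim
  refine hlim.congr fun N => ?_
  rw [← map_infinitePi_initial, Measure.map_apply (hm N) (hA N)]

theorem ae_tendsto_kappa {f : X → ℝ} (hf : Measurable f) (hint : Integrable f μ) :
    ∀ᵐ ω ∂(Measure.infinitePi fun _ : ℕ => μ),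
      Tendsto (fun N : ℕ => kappa fun j : Fin N => f (ω j)) atTop (𝓝 (∫ x, f x ∂μ)) := by
  have heval : ∀ j : ℕ, MeasurePreserving (fun ω : ℕ → X => ω j)
      (Measure.infinitePi fun _ : ℕ => μ) μ := measurePreserving_eval_infinitePi fun _ => μ
  have hindep : ProbabilityTheory.iIndepFun (fun (j : ℕ) (ω : ℕ → X) => f (ω j))
      (Measure.infinitePi fun _ : ℕ => μ) := ProbabilityTheory.iIndepFun_infinitePi fun _ => hf
  have hident : ∀ j : ℕ, ProbabilityTheory.IdentDistrib (fun ω : ℕ → X => f (ω j))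
      (fun ω => f (ω 0)) (Measure.infinitePi fun _ : ℕ => μ)
      (Measure.infinitePi fun _ : ℕ => μ) := fun j =>
    ProbabilityTheory.IdentDistrib.comp ⟨(heval j).aemeasurable, (heval 0).aemeasurable,
      by rw [(heval j).map_eq, (heval 0).map_eq]⟩ hf
  have hmean : ∫ ω, f (ω 0) ∂(Measure.infinitePi fun _ : ℕ => μ) = ∫ x, f x ∂μ := by
    conv_rhs => rw [← (heval 0).map_eq]
    rw [integral_map (heval 0).aemeasurable hf.aestronglyMeasurable]
  filter_upwards [ProbabilityTheory.strong_law_ae (fun (j : ℕ) (ω : ℕ → X) => f (ω j))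
    ((heval 0).integrable_comp_of_integrable hint) (fun a b hab => hindep.indepFun hab) hident]
    with ω hω
  rw [hmean] at hω
  refine hω.congr fun N => ?_
  rw [kappa, one_div, smul_eq_mul, ← Fin.sum_univ_eq_sum_range fun j => f (ω j)]

end LawOfLargeNumbers

section Configurations

variable {R : ℝ} {n : ℕ}

instance isProbabilityMeasure_marginal (μ : Measure (Box R n)) [IsProbabilityMeasure μ]
    (i : Fin n) : IsProbabilityMeasure (marginal μ i) :=
  Measure.isProbabilityMeasure_map (measurable_pi_apply i).aemeasurable

theorem ae_tendsto_moment_marginal (μ : Measure (Box R n)) [IsProbabilityMeasure μ] :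
    ∀ᵐ ω ∂(Measure.infinitePi fun _ : ℕ => μ), ∀ (i : Fin n) (k : ℕ),
      Tendsto (fun N : ℕ => kappa fun j : Fin N => (ω j i : ℝ) ^ k) atTop
        (𝓝 (∫ x, (x : ℝ) ^ k ∂marginal μ i)) := by
  refine ae_all_iff.2 fun i => ae_all_iff.2 fun k => ?_
  let f : C(Box R n, ℝ) := ⟨fun x => (x i : ℝ) ^ k, by fun_prop⟩
  have hint : ∫ x, (x : ℝ) ^ k ∂marginal μ i = ∫ x, f x ∂μ :=
    integral_map (measurable_pi_apply i).aemeasurable (by fun_prop)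
  rw [hint]
  exact ae_tendsto_kappa μ f.continuous.measurable (integrable_continuousMap μ f)

theorem eventually_mem_nearShuffles {ν : Fin n → Measure (Interval R)}
    [∀ i, IsProbabilityMeasure (ν i)] {Ξ : (N : ℕ) → Fin n → Fin N → Interval R}
    (hΞ : IsApproximating ν Ξ) {ω : ℕ → Box R n}
    (hω : ∀ (i : Fin n) (k : ℕ), Tendsto (fun N : ℕ => kappa fun j : Fin N => (ω j i : ℝ) ^ k)
      atTop (𝓝 (∫ x, (x : ℝ) ^ k ∂ν i))) {η : ℝ} (hη : 0 < η) :
    ∀ᶠ N in atTop, (fun j : Fin N => ω j) ∈ nearShuffles (Function.swap (Ξ N)) η := by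
  let s : (N : ℕ) → Fin n → Equiv.Perm (Fin N) := fun N i => Tuple.sort fun l : Fin N => ω l i
  have hsort : ∀ i, Tendsto (fun N => kappa fun j => dist (ω (s N i j) i) (Ξ N i j)) atTop (𝓝 0) :=
    fun i => tendsto_kappa_dist_of_tendsto_moment (a := fun N j => ω (s N i j) i)
      (fun N => Tuple.monotone_sort fun l : Fin N => ω l i) (fun N => hΞ.monotone N i)
      (fun k => (hω i k).congr fun N =>
        (kappa_comp_perm (s N i) fun l : Fin N => (ω l i : ℝ) ^ k).symm)
      (hΞ.tendsto_moment i)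
  have hsum := tendsto_finsetSum Finset.univ fun i _ => hsort i
  simp only [← kappa_sum, Finset.sum_const_zero] at hsum
  filter_upwards [hsum.eventually_lt_const hη] with N hN
  exact ⟨fun i => (s N i)⁻¹, by simpa [meanDist, shuffle, Function.swap] using hN⟩

theorem ae_eventually_mem_nearShuffles {μ : Measure (Box R n)} [IsProbabilityMeasure μ]
    {Ξ : (N : ℕ) → Fin n → Fin N → Interval R} (hΞ : IsApproximating (marginal μ) Ξ)
    {η : ℝ} (hη : 0 < η) :
    ∀ᵐ ω ∂(Measure.infinitePi fun _ : ℕ => μ), ∀ᶠ N in atTop,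
      (fun j : Fin N => ω j) ∈ nearShuffles (Function.swap (Ξ N)) η :=
  (ae_tendsto_moment_marginal μ).mono fun _ hω => eventually_mem_nearShuffles hΞ hω hη

/-- The monomial `x ↦ x_{i_1} ⋯ x_{i_k}` on the box. -/
def monomial {k : ℕ} (i : Fin k → Fin n) : C(Box R n, ℝ) :=
  ⟨fun x => ∏ l, (x (i l) : ℝ), by fun_prop⟩

theorem exists_eq_monomial_of_mem_closure {f : C(Box R n, ℝ)}
    (hf : f ∈ Submonoid.closure (Set.range fun a : Fin n => monomial fun _ : Fin 1 => a)) :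
    ∃ (k : ℕ) (i : Fin k → Fin n), f = monomial i := by
  induction hf using Submonoid.closure_induction with
  | mem x hx =>
    obtain ⟨a, rfl⟩ := hx
    exact ⟨1, fun _ => a, rfl⟩
  | one => exact ⟨0, Fin.elim0, by ext x; simp [monomial]⟩
  | mul x y _ _ hx hy =>
    obtain ⟨k, i, rfl⟩ := hx
    obtain ⟨k', i', rfl⟩ := hy
    exact ⟨k + k', Fin.append i i', by ext x; simp [monomial, Fin.prod_univ_add]⟩

theorem tendsto_kappa_of_tendsto_monomial {μ : Measure (Box R n)} [IsProbabilityMeasure μ]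
    {ι : Type*} {l : Filter ι} {N : ι → ℕ} {x : (a : ι) → Fin (N a) → Box R n}
    (hx : ∀ (k : ℕ) (i : Fin k → Fin n), Tendsto
      (fun a => kappa fun j => (monomial i : C(Box R n, ℝ)) (x a j)) l
      (𝓝 (∫ y, (monomial i : C(Box R n, ℝ)) y ∂μ))) (f : C(Box R n, ℝ)) :
    Tendsto (fun a => kappa fun j => f (x a j)) l (𝓝 (∫ y, f y ∂μ)) := by
  refine tendsto_of_tendsto_monomials (Λ := fun a => kappaLinear (x a)) (Λ₀ := integralLinear μ)
    (fun a f => abs_kappaLinear_le _ f) (abs_integralLinear_le μ)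
    (S := Set.range fun a : Fin n => monomial fun _ : Fin 1 => a) ?_ ?_ f
  · intro y z hyz
    obtain ⟨a, ha⟩ := Function.ne_iff.1 hyz
    refine ⟨_, ⟨_, Algebra.subset_adjoin ⟨a, rfl⟩, rfl⟩, fun h => ha (Subtype.ext ?_)⟩
    simpa [monomial] using h
  · intro g hg
    obtain ⟨k, i, rfl⟩ := exists_eq_monomial_of_mem_closure hg
    exact hx k i

theorem mem_microstates_iff {μ : Measure (Box R n)} {N m : ℕ} {δ : ℝ}
    {x : Fin n → Fin N → Interval R} :
    x ∈ microstates μ N m δ ↔ ∀ k : ℕ, 1 ≤ k → k ≤ m → ∀ i : Fin k → Fin n,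
      |kappa (fun j => (monomial i : C(Box R n, ℝ)) (Function.swap x j))
        - ∫ y, (monomial i : C(Box R n, ℝ)) y ∂μ| < δ := Iff.rfl

theorem measurableSet_microstates (μ : Measure (Box R n)) (N m : ℕ) (δ : ℝ) :
    MeasurableSet {y : Fin N → Box R n | Function.swap y ∈ microstates μ N m δ} := by
  simp only [mem_microstates_iff, Set.ofPred_forall]
  refine MeasurableSet.iInter fun k => MeasurableSet.iInter fun _ => MeasurableSet.iInter fun _ =>
    MeasurableSet.iInter fun i => measurableSet_lt ?_ measurable_const
  unfold kappa
  fun_prop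

theorem ae_eventually_mem_microstates (μ : Measure (Box R n)) [IsProbabilityMeasure μ]
    (m : ℕ) {δ : ℝ} (hδ : 0 < δ) :
    ∀ᵐ ω ∂(Measure.infinitePi fun _ : ℕ => μ), ∀ᶠ N in atTop,
      (Function.swap fun j : Fin N => ω j) ∈ microstates μ N m δ := by
  have hlim : ∀ᵐ ω ∂(Measure.infinitePi fun _ : ℕ => μ), ∀ (k : ℕ) (i : Fin k → Fin n),
      Tendsto (fun N : ℕ => kappa fun j : Fin N => (monomial i : C(Box R n, ℝ)) (ω j)) atTop
        (𝓝 (∫ x, (monomial i : C(Box R n, ℝ)) x ∂μ)) :=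
    ae_all_iff.2 fun k => ae_all_iff.2 fun i =>
      ae_tendsto_kappa μ (monomial i).continuous.measurable (integrable_continuousMap μ _)
  filter_upwards [hlim] with ω hω
  have hclose : ∀ᶠ N : ℕ in atTop, ∀ k ∈ Finset.Icc 1 m, ∀ i : Fin k → Fin n,
      |kappa (fun j : Fin N => (monomial i : C(Box R n, ℝ)) (ω j))
        - ∫ y, (monomial i : C(Box R n, ℝ)) y ∂μ| < δ :=
    (eventually_all_finset _).2 fun k _ => eventually_all.2 fun i =>
      Metric.tendsto_nhds.1 (hω k i) δ hδ
  filter_upwards [hclose] with N hN k hk hkm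
  exact hN k (Finset.mem_Icc.2 ⟨hk, hkm⟩)

theorem exists_abs_kappa_sub_integral_le_of_mem_microstates (μ : Measure (Box R n))
    [IsProbabilityMeasure μ] (h : C(Box R n, ℝ)) {ε : ℝ} (hε : 0 < ε) :
    ∃ (m : ℕ) (δ : ℝ), 0 < δ ∧ ∀ N : ℕ, 0 < N → ∀ x ∈ microstates μ N m δ,
      |kappa (fun j => h (Function.swap x j)) - ∫ y, h y ∂μ| ≤ ε := by
  by_contra! hcon
  choose N hN x hx hfar using fun k : ℕ => hcon k (1 / ((k : ℝ) + 1)) (by positivity)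
  have hlim : Tendsto (fun k => kappa fun j => h (Function.swap (x k) j)) atTop
      (𝓝 (∫ y, h y ∂μ)) := by
    refine tendsto_kappa_of_tendsto_monomial (fun q i => ?_) h
    rcases q.eq_zero_or_pos with rfl | hq
    · simp [monomial, kappa_const (hN _)]
    · rw [tendsto_iff_dist_tendsto_zero]
      refine squeeze_zero' (Eventually.of_forall fun k => dist_nonneg) ?_
        (tendsto_one_div_add_atTop_nhds_zero_nat (𝕜 := ℝ))
      filter_upwards [eventually_ge_atTop q] with k hk
      exact (mem_microstates_iff.1 (hx k) q hq hk i).le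
  obtain ⟨k, hk⟩ := (Metric.tendsto_nhds.1 hlim ε hε).exists
  exact (hfar k).not_gt hk

end Configurations

section GrowthRates

open ExpGrowth

variable {R : ℝ} {n : ℕ}

/-- The proportion in `S_N^n` of the discrete microstates `Δ_sym(μ : Ξ(N); N, m, δ)`. -/
noncomputable def symProportion (μ : Measure (Box R n))
    (Ξ : (N : ℕ) → Fin n → Fin N → Interval R) (m : ℕ) (δ : ℝ) (N : ℕ) : ENNReal :=
  (symMicrostates μ Ξ N m δ).ncard / (N.factorial : ENNReal) ^ n

/-- The partition function `(N!)⁻ⁿ ∑_σ exp (∑_j h (σ(Ξ(N))_j))`, whose exponential growth rate is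
the mutual pressure. -/
noncomputable def partitionFunction (Ξ : (N : ℕ) → Fin n → Fin N → Interval R)
    (h : C(Box R n, ℝ)) (N : ℕ) : ENNReal :=
  (∑ σ, ENNReal.ofReal (Real.exp (N * kappa fun j => h (shuffle σ (Function.swap (Ξ N)) j)))) /
    (N.factorial : ENNReal) ^ n

theorem coe_one_div_mul_eq_div (N : ℕ) (x : EReal) :
    (((1 / (N : ℝ)) : ℝ) : EReal) * x = x / N := by
  rw [EReal.div_eq_inv_mul, one_div, EReal.coe_inv, EReal.coe_natCast]

theorem symRate_eq_expGrowthSup (μ : Measure (Box R n))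
    (Ξ : (N : ℕ) → Fin n → Fin N → Interval R) (m : ℕ) (δ : ℝ) :
    symRate μ Ξ m δ = expGrowthSup (symProportion μ Ξ m δ) := by
  simp only [symRate, coe_one_div_mul_eq_div]
  rfl

theorem mutualPressure_eq_expGrowthSup (Ξ : (N : ℕ) → Fin n → Fin N → Interval R)
    (h : C(Box R n, ℝ)) : mutualPressure Ξ h = expGrowthSup (partitionFunction Ξ h) := by
  refine limsup_congr (Eventually.of_forall fun N => ?_)
  have : 0 < ∑ σ : Fin n → Equiv.Perm (Fin N),
      Real.exp (N * kappa fun j => h fun i => permute σ (Ξ N) i j) :=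
    Finset.sum_pos (fun σ _ => Real.exp_pos _) Finset.univ_nonempty
  have hZ : partitionFunction Ξ h N = ENNReal.ofReal (1 / (N.factorial : ℝ) ^ n *
      ∑ σ, Real.exp (N * kappa fun j => h fun i => permute σ (Ξ N) i j)) := by
    rw [one_div_mul_eq_div, ENNReal.ofReal_div_of_pos (by positivity),
      ENNReal.ofReal_sum_of_nonneg fun σ _ => (Real.exp_pos _).le,
      ENNReal.ofReal_pow (by positivity), ENNReal.ofReal_natCast]
    rfl
  rw [EReal.coe_mul, coe_one_div_mul_eq_div, hZ, ENNReal.log_ofReal_of_pos (by positivity)]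

theorem card_perm_tuples (n N : ℕ) :
    Fintype.card (Fin n → Equiv.Perm (Fin N)) = N.factorial ^ n := by
  simp [Fintype.card_perm]

theorem eventually_half_le {u : ℕ → ENNReal} (hu : Tendsto u atTop (𝓝 1)) :
    ∀ᶠ N in atTop, 2⁻¹ ≤ u N :=
  (hu.eventually_const_lt (by simp : (2 : ENNReal)⁻¹ < 1)).mono fun _ h => h.le

end GrowthRates

section PressureUpperBound

open ExpGrowth

variable {R : ℝ} {n : ℕ}

theorem marginal_pi (ν : Fin n → Measure (Interval R)) [∀ i, IsProbabilityMeasure (ν i)] :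
    marginal (Measure.pi ν) = ν :=
  funext fun i => (measurePreserving_eval ν i).map_eq

theorem lintegral_exp_kappa {X : Type*} [MeasurableSpace X] (π : Measure X) [SigmaFinite π]
    {f : X → ℝ} (hf : Measurable f) (N : ℕ) :
    ∫⁻ y : Fin N → X, ENNReal.ofReal (Real.exp (N * kappa fun j => f (y j)))
        ∂Measure.pi (fun _ => π) =
      (∫⁻ x, ENNReal.ofReal (Real.exp (f x)) ∂π) ^ N := by
  simp_rw [natCast_mul_kappa, Real.exp_sum,
    ENNReal.ofReal_prod_of_nonneg fun _ _ => (Real.exp_pos _).le]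
  rw [lintegral_fintype_prod_eq_prod (f := fun _ x => ENNReal.ofReal (Real.exp (f x)))
    fun _ => by fun_prop]
  simp

theorem partitionFunction_mul_pi_nearShuffles_le {ν : Fin n → Measure (Interval R)}
    [∀ i, IsProbabilityMeasure (ν i)] (Ξ : (N : ℕ) → Fin n → Fin N → Interval R)
    {h : C(Box R n, ℝ)} {ε η : ℝ} {N : ℕ}
    (hη : ∀ x y : Fin N → Box R n, meanDist x y < η →
      |kappa (fun j => h (x j)) - kappa (fun j => h (y j))| ≤ ε) :
    partitionFunction Ξ h N *
        Measure.pi (fun _ => Measure.pi ν) (nearShuffles (Function.swap (Ξ N)) η) ≤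
      (∫⁻ x, ENNReal.ofReal (Real.exp (h x + ε)) ∂Measure.pi ν) ^ N := by
  have hle := sum_mul_measure_le_lintegral ν
    (F := fun y => ENNReal.ofReal (Real.exp (N * kappa fun j : Fin N => h (y j) + ε)))
    (c := fun σ => ENNReal.ofReal (Real.exp (N * kappa fun j =>
      h (shuffle σ (Function.swap (Ξ N)) j))))
    (by unfold kappa; fun_prop) (G := nearShuffles (Function.swap (Ξ N)) η) <| by
      rintro y ⟨τ, hτ⟩
      refine ⟨τ, fun σ => ENNReal.ofReal_le_ofReal (Real.exp_le_exp.2 ?_)⟩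
      rw [← meanDist_shuffle σ] at hτ
      have := (abs_le.1 (hη _ _ hτ)).1
      rcases N.eq_zero_or_pos with rfl | hN
      · simp
      rw [kappa_add, kappa_const hN]
      gcongr
      linarith
  rw [lintegral_exp_kappa (Measure.pi ν) (f := fun x => h x + ε) (by fun_prop),
    card_perm_tuples] at hle
  rw [partitionFunction, ENNReal.mul_comm_div, ← mul_div_assoc]
  refine ENNReal.div_le_of_le_mul ?_
  rw [mul_comm _ ((N.factorial : ENNReal) ^ n)]
  exact_mod_cast hle

theorem log_lintegral_exp_add {X : Type*} [MeasurableSpace X] {π : Measure X} [NeZero π]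
    {f : X → ℝ} (hf : Integrable (fun x => Real.exp (f x)) π) (ε : ℝ) :
    ENNReal.log (∫⁻ x, ENNReal.ofReal (Real.exp (f x + ε)) ∂π) =
      ((Real.log (∫ x, Real.exp (f x) ∂π) + ε : ℝ) : EReal) := by
  have hpos : 0 < ∫ x, Real.exp (f x) ∂π := integral_exp_pos hf
  simp_rw [Real.exp_add]
  rw [← ofReal_integral_eq_lintegral_ofReal (hf.mul_const _) (ae_of_all _ fun x => by positivity),
    integral_mul_const, ENNReal.log_ofReal_of_pos (by positivity),
    Real.log_mul hpos.ne' (Real.exp_pos _).ne', Real.log_exp]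

theorem mutualPressure_le_log_integral_exp {ν : Fin n → Measure (Interval R)}
    [∀ i, IsProbabilityMeasure (ν i)] {Ξ : (N : ℕ) → Fin n → Fin N → Interval R}
    (hΞ : IsApproximating ν Ξ) (h : C(Box R n, ℝ)) :
    mutualPressure Ξ h ≤ ((Real.log (∫ x, Real.exp (h x) ∂Measure.pi ν) : ℝ) : EReal) := by
  rw [← marginal_pi ν] at hΞ
  refine EReal.le_of_forall_lt_iff_le.1 fun z hz => ?_
  rw [EReal.coe_lt_coe_iff, ← sub_pos] at hz
  obtain ⟨η, hη, hclose⟩ := exists_abs_kappa_sub_le_of_meanDist_lt h hz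
  have hnear := eventually_half_le (tendsto_pi_of_ae_eventually_mem (Measure.pi ν)
    (fun N => (isOpen_nearShuffles (Function.swap (Ξ N)) η).measurableSet)
    (ae_eventually_mem_nearShuffles hΞ hη))
  have hint : Integrable (fun x => Real.exp (h x)) (Measure.pi ν) :=
    integrable_continuousMap _ ⟨fun x => Real.exp (h x), by fun_prop⟩
  rw [← add_sub_cancel (Real.log _) z, ← log_lintegral_exp_add hint, ← expGrowthSup_pow,
    mutualPressure_eq_expGrowthSup]
  refine expGrowthSup_le_of_eventually_le (b := 2) (by simp) ?_
  filter_upwards [hnear] with N hN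
  calc partitionFunction Ξ h N
      = 2 * (partitionFunction Ξ h N * 2⁻¹) := by
        rw [mul_left_comm, ENNReal.mul_inv_cancel (by simp) (by simp), mul_one]
    _ ≤ _ := by
        gcongr
        exact (mul_le_mul_right hN _).trans
          (partitionFunction_mul_pi_nearShuffles_le Ξ (hclose N))

end PressureUpperBound

section LegendreTransform

open ExpGrowth

variable {R : ℝ} {n : ℕ}

theorem klDiv_le_legendreISym (μ : Measure (Box R n)) [IsProbabilityMeasure μ]
    {Ξ : (N : ℕ) → Fin n → Fin N → Interval R} (hΞ : IsApproximating (marginal μ) Ξ) :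
    (InformationTheory.klDiv μ (Measure.pi (marginal μ)) : EReal) ≤ legendreISym μ Ξ := by
  have hle : ∀ h : C(Box R n, ℝ), ((∫ x, h x ∂μ
      - Real.log (∫ x, Real.exp (h x) ∂Measure.pi (marginal μ)) : ℝ) : EReal) ≤
        legendreISym μ Ξ := fun h => by
    refine le_iSup_of_le h ?_
    rw [EReal.coe_sub]
    exact EReal.sub_le_sub le_rfl (mutualPressure_le_log_integral_exp hΞ h)
  have hnonneg : 0 ≤ legendreISym μ Ξ := by simpa using hle 0
  induction hL : legendreISym μ Ξ with
  | bot => simp [hL] at hnonneg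
  | top => exact le_top
  | coe C =>
    simp only [hL, EReal.coe_le_coe_iff] at hle
    rw [hL, EReal.coe_nonneg] at hnonneg
    rw [← max_eq_left hnonneg, ← EReal.coe_ennreal_ofReal, EReal.coe_ennreal_le_coe_ennreal_iff]
    exact klDiv_le_of_forall_continuous hle

theorem symProportion_eq_sum_indicator (μ : Measure (Box R n))
    (Ξ : (N : ℕ) → Fin n → Fin N → Interval R) (m : ℕ) (δ : ℝ) (N : ℕ) :
    symProportion μ Ξ m δ N =
      (∑ σ, (symMicrostates μ Ξ N m δ).indicator 1 σ) / (N.factorial : ENNReal) ^ n := by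
  classical
  rw [symProportion, Set.ncard_eq_toFinset_card']
  simp [Set.indicator_apply, Finset.sum_boole]

theorem symProportion_mul_exp_le_partitionFunction (μ : Measure (Box R n))
    (Ξ : (N : ℕ) → Fin n → Fin N → Interval R) {h : C(Box R n, ℝ)} {m N : ℕ} {δ a : ℝ}
    (ha : ∀ x ∈ microstates μ N m δ, a ≤ kappa fun j => h (Function.swap x j)) :
    symProportion μ Ξ m δ N * ENNReal.ofReal (Real.exp (a * N)) ≤ partitionFunction Ξ h N := by
  rw [symProportion_eq_sum_indicator, partitionFunction, ENNReal.mul_comm_div, ← mul_div_assoc,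
    Finset.sum_mul]
  gcongr with σ
  by_cases hσ : σ ∈ symMicrostates μ Ξ N m δ
  · rw [Set.indicator_of_mem hσ, Pi.one_apply, one_mul, mul_comm a]
    gcongr
    exact ha _ hσ
  · simp [hσ]

theorem symRate_add_le_mutualPressure (μ : Measure (Box R n))
    (Ξ : (N : ℕ) → Fin n → Fin N → Interval R) {h : C(Box R n, ℝ)} {m : ℕ} {δ a : ℝ}
    (ha : ∀ N : ℕ, 0 < N → ∀ x ∈ microstates μ N m δ,
      a ≤ kappa fun j => h (Function.swap x j)) :
    symRate μ Ξ m δ + a ≤ mutualPressure Ξ h := by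
  rw [symRate_eq_expGrowthSup, mutualPressure_eq_expGrowthSup,
    ← expGrowthInf_exp (a := (a : EReal))]
  refine le_expGrowthSup_mul.trans (expGrowthSup_eventually_monotone ?_)
  filter_upwards [eventually_gt_atTop 0] with N hN
  rw [Pi.mul_apply, ← EReal.coe_natCast, ← EReal.coe_mul, EReal.exp_coe]
  exact symProportion_mul_exp_le_partitionFunction μ Ξ (ha N hN)

theorem legendreISym_le_ISym (μ : Measure (Box R n)) [IsProbabilityMeasure μ]
    (Ξ : (N : ℕ) → Fin n → Fin N → Interval R) : legendreISym μ Ξ ≤ ISym μ Ξ := by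
  refine iSup_le fun h => ?_
  have hinf : ∀ a < ∫ x, h x ∂μ,
      (⨅ (m : ℕ) (δ : ℝ) (_ : 0 < δ), symRate μ Ξ m δ) ≤ mutualPressure Ξ h - a := fun a ha => by
    obtain ⟨m, δ, hδ, hclose⟩ :=
      exists_abs_kappa_sub_integral_le_of_mem_microstates μ h (sub_pos.2 ha)
    refine iInf_le_of_le m (iInf₂_le_of_le δ hδ ?_)
    rw [EReal.le_sub_iff_add_le (by simp) (by simp)]
    refine symRate_add_le_mutualPressure μ Ξ fun N hN x hx => ?_
    linarith [(abs_le.1 (hclose N hN x hx)).1]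
  rw [ISym, EReal.le_neg, EReal.neg_sub (by simp) (by simp), add_comm, ← sub_eq_add_neg]
  refine EReal.le_of_forall_lt_iff_le.1 fun w hw => ?_
  rw [EReal.sub_lt_iff (by simp) (by simp)] at hw
  obtain ⟨p, hp, hpw⟩ := EReal.lt_iff_exists_real_btwn.1 hw
  have hpw' : p < w + ∫ x, h x ∂μ := by exact_mod_cast hpw
  calc _ ≤ mutualPressure Ξ h - (p - w : ℝ) := hinf (p - w) (by linarith)
    _ ≤ (p : EReal) - (p - w : ℝ) := EReal.sub_le_sub hp.le le_rfl
    _ = w := by rw [← EReal.coe_sub, sub_sub_cancel]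

end LegendreTransform

section MicrostatesLowerBound

open ExpGrowth

variable {R : ℝ} {n : ℕ}

theorem exists_swap_mem_microstates_of_meanDist_lt (μ : Measure (Box R n)) (m : ℕ) {δ δ' : ℝ}
    (hδ : δ < δ') :
    ∃ η : ℝ, 0 < η ∧ ∀ (N : ℕ) (x y : Fin N → Box R n), meanDist x y < η →
      Function.swap x ∈ microstates μ N m δ → Function.swap y ∈ microstates μ N m δ' := by
  have hev : ∀ᶠ η in 𝓝[>] (0 : ℝ), ∀ k ∈ Finset.Icc 1 m, ∀ (i : Fin k → Fin n) (N : ℕ)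
      (x y : Fin N → Box R n), meanDist x y < η →
      |kappa (fun j => (monomial i : C(Box R n, ℝ)) (x j))
        - kappa (fun j => (monomial i : C(Box R n, ℝ)) (y j))| ≤ δ' - δ := by
    refine (eventually_all_finset _).2 fun k _ => eventually_all.2 fun i => ?_
    obtain ⟨η, hη, hclose⟩ :=
      exists_abs_kappa_sub_le_of_meanDist_lt (monomial i : C(Box R n, ℝ)) (sub_pos.2 hδ)
    filter_upwards [Ioo_mem_nhdsGT hη] with η' hη' N x y hxy
    exact hclose N x y (hxy.trans hη'.2)
  obtain ⟨η, hclose, hη⟩ := (hev.and self_mem_nhdsWithin).exists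
  refine ⟨η, hη, fun N x y hxy hx => mem_microstates_iff.2 fun k hk hkm i => ?_⟩
  have hxy := hclose k (Finset.mem_Icc.2 ⟨hk, hkm⟩) i N x y hxy
  rw [abs_sub_comm] at hxy
  exact (abs_sub_le _ _ _).trans_lt (by linarith [mem_microstates_iff.1 hx k hk hkm i])

theorem pi_microstates_inter_nearShuffles_le_symProportion {ν : Fin n → Measure (Interval R)}
    [∀ i, IsProbabilityMeasure (ν i)] {μ : Measure (Box R n)}
    (Ξ : (N : ℕ) → Fin n → Fin N → Interval R) {m N : ℕ} {δ δ' η : ℝ}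
    (hη : ∀ x y : Fin N → Box R n, meanDist x y < η →
      Function.swap x ∈ microstates μ N m δ → Function.swap y ∈ microstates μ N m δ') :
    Measure.pi (fun _ => Measure.pi ν) ({y | Function.swap y ∈ microstates μ N m δ} ∩
      nearShuffles (Function.swap (Ξ N)) η) ≤ symProportion μ Ξ m δ' N := by
  set E := {y : Fin N → Box R n | Function.swap y ∈ microstates μ N m δ} ∩
    nearShuffles (Function.swap (Ξ N)) η
  have hE : MeasurableSet E :=
    (measurableSet_microstates μ N m δ).inter (isOpen_nearShuffles _ _).measurableSet
  have hle := lintegral_le_sum ν (F := E.indicator 1) (measurable_one.indicator hE)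
    (c := (symMicrostates μ Ξ N m δ').indicator 1) <| by
      intro y
      by_cases hy : y ∈ nearShuffles (Function.swap (Ξ N)) η
      · obtain ⟨τ, hτ⟩ := hy
        have hσ : ∀ σ, shuffle σ (shuffle τ y) ∈ E → σ ∈ symMicrostates μ Ξ N m δ' := fun σ h =>
          hη _ (shuffle σ (Function.swap (Ξ N))) (by rwa [meanDist_shuffle]) h.1
        exact ⟨τ, fun σ => Set.indicator_apply_le' (fun h => by simp [hσ σ h]) fun _ => zero_le⟩
      · refine ⟨1, fun σ => ?_⟩
        have hσ : shuffle σ (shuffle 1 y) ∉ E := fun h =>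
          hy (by simpa only [shuffle_mem_nearShuffles_iff] using h.2)
        simp [hσ]
  rw [lintegral_indicator_one hE, card_perm_tuples] at hle
  rw [symProportion_eq_sum_indicator,
    ENNReal.le_div_iff_mul_le (by simp [Nat.factorial_ne_zero]) (by simp), mul_comm]
  exact_mod_cast hle

/-- The typical points of `μ ^ N` in the sense of asymptotic equipartition: microstates of `μ` close
to a shuffle of `Ξ(N)` at which the mean log-likelihood ratio of `μ` to the product of its
marginals is less than `c`. -/
def typicalSet (μ : Measure (Box R n)) (Ξ : (N : ℕ) → Fin n → Fin N → Interval R) (m : ℕ)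
    (δ η c : ℝ) (N : ℕ) : Set (Fin N → Box R n) :=
  ({y | Function.swap y ∈ microstates μ N m δ} ∩ nearShuffles (Function.swap (Ξ N)) η) ∩
    {y | kappa (fun j => llr μ (Measure.pi (marginal μ)) (y j)) < c}

theorem measurableSet_typicalSet (μ : Measure (Box R n))
    (Ξ : (N : ℕ) → Fin n → Fin N → Interval R) (m : ℕ) (δ η c : ℝ) (N : ℕ) :
    MeasurableSet (typicalSet μ Ξ m δ η c N) := by
  refine ((measurableSet_microstates μ N m δ).inter
    (isOpen_nearShuffles _ _).measurableSet).inter (measurableSet_lt ?_ measurable_const)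
  have := measurable_llr μ (Measure.pi (marginal μ))
  unfold kappa
  fun_prop

theorem tendsto_pi_typicalSet {μ : Measure (Box R n)} [IsProbabilityMeasure μ]
    {Ξ : (N : ℕ) → Fin n → Fin N → Interval R} (hΞ : IsApproximating (marginal μ) Ξ)
    (hint : Integrable (llr μ (Measure.pi (marginal μ))) μ) (m : ℕ) {δ η c : ℝ} (hδ : 0 < δ)
    (hη : 0 < η) (hc : ∫ x, llr μ (Measure.pi (marginal μ)) x ∂μ < c) :
    Tendsto (fun N => Measure.pi (fun _ : Fin N => μ) (typicalSet μ Ξ m δ η c N)) atTop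
      (𝓝 1) := by
  refine tendsto_pi_of_ae_eventually_mem μ (measurableSet_typicalSet μ Ξ m δ η c) ?_
  filter_upwards [ae_eventually_mem_microstates μ m hδ, ae_eventually_mem_nearShuffles hΞ hη,
    ae_tendsto_kappa μ (measurable_llr μ _) hint] with ω hmicro hnear hllr
  filter_upwards [hmicro, hnear, hllr.eventually_lt_const hc] with N hN₁ hN₂ hN₃
  exact ⟨⟨hN₁, hN₂⟩, hN₃⟩

theorem pi_typicalSet_le_exp_mul_symProportion {μ : Measure (Box R n)} [IsProbabilityMeasure μ]
    (hac : μ ≪ Measure.pi (marginal μ)) (Ξ : (N : ℕ) → Fin n → Fin N → Interval R) {m N : ℕ}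
    {δ δ' η : ℝ} (c : ℝ)
    (hη : ∀ x y : Fin N → Box R n, meanDist x y < η →
      Function.swap x ∈ microstates μ N m δ → Function.swap y ∈ microstates μ N m δ') :
    Measure.pi (fun _ => μ) (typicalSet μ Ξ m δ η c N) ≤
      ENNReal.ofReal (Real.exp (N * c)) * symProportion μ Ξ m δ' N := by
  refine (pi_le_exp_mul_pi_of_sum_llr_le hac (measurableSet_typicalSet μ Ξ m δ η c N)
    fun y hy => ?_).trans (mul_le_mul_right ((measure_mono Set.inter_subset_left).trans
      (pi_microstates_inter_nearShuffles_le_symProportion Ξ hη)) _)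
  rw [← natCast_mul_kappa]
  exact mul_le_mul_of_nonneg_left hy.2.le N.cast_nonneg

theorem neg_integral_llr_le_symRate {μ : Measure (Box R n)} [IsProbabilityMeasure μ]
    {Ξ : (N : ℕ) → Fin n → Fin N → Interval R} (hΞ : IsApproximating (marginal μ) Ξ)
    (hac : μ ≪ Measure.pi (marginal μ))
    (hint : Integrable (llr μ (Measure.pi (marginal μ))) μ) (m : ℕ) {δ : ℝ} (hδ : 0 < δ) :
    ((-∫ x, llr μ (Measure.pi (marginal μ)) x ∂μ : ℝ) : EReal) ≤ symRate μ Ξ m δ := by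
  refine EReal.ge_of_forall_gt_iff_ge.1 fun z hz => ?_
  rw [EReal.coe_lt_coe_iff, lt_neg] at hz
  obtain ⟨η, hη, hstable⟩ := exists_swap_mem_microstates_of_meanDist_lt μ m (half_lt_self hδ)
  rw [symRate_eq_expGrowthSup, ← expGrowthSup_exp (a := (z : EReal))]
  refine expGrowthSup_of_eventually_ge (b := 2⁻¹) (by simp) ?_
  filter_upwards [eventually_half_le (tendsto_pi_typicalSet hΞ hint m (half_pos hδ) hη hz)]
    with N hN
  rw [← EReal.coe_natCast, ← EReal.coe_mul, EReal.exp_coe]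
  calc 2⁻¹ * ENNReal.ofReal (Real.exp (z * N))
      ≤ ENNReal.ofReal (Real.exp (N * -z)) * symProportion μ Ξ m δ N *
        ENNReal.ofReal (Real.exp (z * N)) := by
        gcongr
        exact hN.trans (pi_typicalSet_le_exp_mul_symProportion hac Ξ (-z) (hstable N))
    _ = symProportion μ Ξ m δ N := by
        rw [mul_right_comm, ← ENNReal.ofReal_mul (Real.exp_pos _).le, ← Real.exp_add]
        simp [mul_comm (N : ℝ)]

theorem ISym_le_klDiv (μ : Measure (Box R n)) [IsProbabilityMeasure μ]
    {Ξ : (N : ℕ) → Fin n → Fin N → Interval R} (hΞ : IsApproximating (marginal μ) Ξ) :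
    ISym μ Ξ ≤ (InformationTheory.klDiv μ (Measure.pi (marginal μ)) : EReal) := by
  by_cases htop : InformationTheory.klDiv μ (Measure.pi (marginal μ)) = ⊤
  · simp [htop]
  obtain ⟨hac, hint⟩ := InformationTheory.klDiv_ne_top_iff.1 htop
  rw [← EReal.coe_ennreal_toReal htop, InformationTheory.toReal_klDiv_of_measure_eq hac (by simp),
    ISym, EReal.neg_le, ← EReal.coe_neg]
  exact le_iInf fun m => le_iInf₂ fun δ hδ => neg_integral_llr_le_symRate hΞ hac hint m hδ

end MicrostatesLowerBound

section LogLikelihoodRatio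

theorem ae_toReal_rnDeriv_pos {X : Type*} [MeasurableSpace X] {μ π : Measure X} [SigmaFinite μ]
    [SigmaFinite π] (hac : μ ≪ π) : ∀ᵐ x ∂μ, 0 < (μ.rnDeriv π x).toReal := by
  filter_upwards [Measure.rnDeriv_pos hac, hac.ae_le (Measure.rnDeriv_lt_top μ π)] with x hpos htop
  exact ENNReal.toReal_pos hpos.ne' htop.ne

theorem llr_add_llr {X : Type*} [MeasurableSpace X] {μ π κ : Measure X} [SigmaFinite μ]
    [SigmaFinite π] [SigmaFinite κ] (hμπ : μ ≪ π) (hπκ : π ≪ κ) :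
    llr μ π + llr π κ =ᵐ[μ] llr μ κ := by
  filter_upwards [(hμπ.trans hπκ).ae_le (Measure.rnDeriv_mul_rnDeriv (κ := κ) hμπ),
    ae_toReal_rnDeriv_pos hμπ, hμπ.ae_le (ae_toReal_rnDeriv_pos hπκ)]
    with x hmul hμπ_pos hπκ_pos
  rw [Pi.add_apply, llr, llr, llr, ← hmul, Pi.mul_apply, ENNReal.toReal_mul,
    Real.log_mul hμπ_pos.ne' hπκ_pos.ne']

variable {ι : Type*} [Fintype ι] {X : ι → Type*} [∀ i, MeasurableSpace (X i)]
  {ν L : ∀ i, Measure (X i)} [∀ i, SigmaFinite (ν i)] [∀ i, SigmaFinite (L i)]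

theorem pi_eq_withDensity_prod_rnDeriv (hνL : ∀ i, ν i ≪ L i) :
    Measure.pi ν = (Measure.pi L).withDensity fun x => ∏ i, (ν i).rnDeriv (L i) (x i) := by
  have hν : ∀ i, (L i).withDensity ((ν i).rnDeriv (L i)) = ν i :=
    fun i => Measure.withDensity_rnDeriv_eq _ _ (hνL i)
  have (i : ι) : SigmaFinite ((L i).withDensity ((ν i).rnDeriv (L i))) := by
    rw [hν i]; infer_instance
  rw [← pi_withDensity fun i => Measure.measurable_rnDeriv (ν i) (L i)]
  simp only [hν]

theorem pi_absolutelyContinuous_pi (hνL : ∀ i, ν i ≪ L i) : Measure.pi ν ≪ Measure.pi L := by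
  rw [pi_eq_withDensity_prod_rnDeriv hνL]
  exact withDensity_absolutelyContinuous _ _

theorem llr_pi (hνL : ∀ i, ν i ≪ L i) :
    llr (Measure.pi ν) (Measure.pi L) =ᵐ[Measure.pi ν]
      fun x => ∑ i, llr (ν i) (L i) (x i) := by
  have hdensity : (Measure.pi ν).rnDeriv (Measure.pi L) =ᵐ[Measure.pi L]
      fun x => ∏ i, (ν i).rnDeriv (L i) (x i) := by
    conv_lhs => rw [pi_eq_withDensity_prod_rnDeriv hνL]
    exact Measure.rnDeriv_withDensity _ (by fun_prop)
  have hpos : ∀ᵐ x ∂Measure.pi ν, ∀ i, 0 < ((ν i).rnDeriv (L i) (x i)).toReal :=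
    ae_all_iff.2 fun i => (Measure.quasiMeasurePreserving_eval ν i).ae
      (ae_toReal_rnDeriv_pos (hνL i))
  filter_upwards [(pi_absolutelyContinuous_pi hνL).ae_le hdensity, hpos] with x hx hxpos
  rw [llr, hx, ENNReal.toReal_prod, Real.log_prod fun i _ => (hxpos i).ne']
  rfl

end LogLikelihoodRatio

section Entropy

theorem coe_sum {ι : Type*} (s : Finset ι) (f : ι → ℝ) :
    ((∑ i ∈ s, f i : ℝ) : EReal) = ∑ i ∈ s, (f i : EReal) := by
  classical
  induction s using Finset.induction_on with
  | empty => simp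
  | insert i s hi ih => rw [Finset.sum_insert hi, Finset.sum_insert hi, EReal.coe_add, ih]

section ReferenceMeasure

variable {X : Type*} [MeasurableSpace X] {L μ : Measure X}

theorem entropy_eq_neg_integral_llr [SigmaFinite L] [IsFiniteMeasure μ] (hac : μ ≪ L)
    (hint : Integrable (llr μ L) μ) : entropy L μ = ((-∫ x, llr μ L x ∂μ : ℝ) : EReal) := by
  rw [entropy, if_pos ⟨hac, (integrable_rnDeriv_mul_log_iff hac).2 hint⟩,
    integral_rnDeriv_mul_log hac]

theorem entropy_ne_bot_iff [SigmaFinite L] [IsFiniteMeasure μ] :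
    entropy L μ ≠ ⊥ ↔ μ ≪ L ∧ Integrable (llr μ L) μ := by
  refine ⟨fun h => ?_, fun h => by simp [entropy_eq_neg_integral_llr h.1 h.2]⟩
  by_contra hcon
  refine h (if_neg fun hpos => hcon ⟨hpos.1, (integrable_rnDeriv_mul_log_iff hpos.1).1 hpos.2⟩)

end ReferenceMeasure

variable {ι : Type*} [Fintype ι] {X : ι → Type*} [∀ i, MeasurableSpace (X i)]
  {L : ∀ i, Measure (X i)} [∀ i, IsFiniteMeasure (L i)]
  {μ : Measure (∀ i, X i)} [IsProbabilityMeasure μ]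

theorem entropy_map_eval_ne_bot (h : entropy (Measure.pi L) μ ≠ ⊥) (i : ι) :
    entropy (L i) (μ.map (Function.eval i)) ≠ ⊥ := by
  classical
  obtain ⟨hac, hint⟩ := entropy_ne_bot_iff.1 h
  have hL : ∀ j, L j Set.univ ≠ 0 := fun j hj => IsProbabilityMeasure.ne_zero μ <| by
    refine Measure.measure_univ_eq_zero.1 (hac ?_)
    rw [Measure.pi_univ, Finset.prod_eq_zero (Finset.mem_univ j) hj]
  have hmap := Measure.pi_map_eval L i
  set c := ∏ j ∈ Finset.univ.erase i, L j Set.univ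
  have hc : c ≠ 0 := Finset.prod_ne_zero_iff.2 fun j _ => hL j
  have hc' : c ≠ ⊤ := ENNReal.prod_ne_top fun j _ => measure_ne_top _ _
  have hac_i := hac.map (measurable_pi_apply i)
  have hint_i := InformationTheory.integrable_llr_map hac (measurable_pi_apply i) hint
  have hac_L : μ.map (Function.eval i) ≪ L i := by
    rw [hmap] at hac_i
    exact hac_i.trans Measure.smul_absolutelyContinuous
  rw [hmap, integrable_congr (llr_smul_right hac_L c hc hc')] at hint_i
  refine entropy_ne_bot_iff.2 ⟨hac_L, ?_⟩
  exact (hint_i.add (integrable_const (Real.log c.toReal))).congr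
    (ae_of_all _ fun x => sub_add_cancel _ _)

theorem absolutelyContinuous_pi_map_eval (hac : μ ≪ Measure.pi L)
    (hac_i : ∀ i, μ.map (Function.eval i) ≪ L i) :
    μ ≪ Measure.pi fun i => μ.map (Function.eval i) := by
  have hpos : ∀ᵐ x ∂μ, ∀ i, 0 < (μ.map (Function.eval i)).rnDeriv (L i) (x i) :=
    ae_all_iff.2 fun i => ae_of_ae_map (measurable_pi_apply i).aemeasurable
      (Measure.rnDeriv_pos (hac_i i))
  refine Measure.AbsolutelyContinuous.mk fun s _ hs => ?_
  rw [pi_eq_withDensity_prod_rnDeriv hac_i,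
    withDensity_apply_eq_zero (by fun_prop)] at hs
  refine measure_mono_null_ae ?_ (hac hs)
  filter_upwards [hpos] with x hx hxs
  exact ⟨Finset.prod_ne_zero_iff.2 fun i _ => (hx i).ne', hxs⟩

theorem sum_entropy_map_eval
    (h : ∀ i, entropy (L i) (μ.map (Function.eval i)) ≠ ⊥) :
    ∑ i, entropy (L i) (μ.map (Function.eval i)) =
      ((-∫ x, ∑ i, llr (μ.map (Function.eval i)) (L i) (x i) ∂μ : ℝ) : EReal) := by
  simp only [entropy_ne_bot_iff] at h
  have hint (i : ι) : Integrable (fun x => llr (μ.map (Function.eval i)) (L i) (x i)) μ :=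
    (h i).2.comp_measurable (measurable_pi_apply i)
  rw [integral_finsetSum _ fun i _ => hint i, ← Finset.sum_neg_distrib, coe_sum]
  refine Finset.sum_congr rfl fun i _ => ?_
  rw [entropy_eq_neg_integral_llr (h i).1 (h i).2,
    integral_map (measurable_pi_apply i).aemeasurable
      (stronglyMeasurable_llr _ _).aestronglyMeasurable]

theorem entropy_pi_eq_neg_klDiv_add_of_ne_bot
    (h : ∀ i, entropy (L i) (μ.map (Function.eval i)) ≠ ⊥) :
    entropy (Measure.pi L) μ =
      -(InformationTheory.klDiv μ (Measure.pi fun i => μ.map (Function.eval i)) : EReal) +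
        ∑ i, entropy (L i) (μ.map (Function.eval i)) := by
  have hprob (i : ι) : IsProbabilityMeasure (μ.map (Function.eval i)) :=
    Measure.isProbabilityMeasure_map (measurable_pi_apply i).aemeasurable
  rw [sum_entropy_map_eval h]
  simp only [entropy_ne_bot_iff, forall_and] at h
  obtain ⟨hac_i, hint_i⟩ := h
  have hsum : Integrable (fun x => ∑ i, llr (μ.map (Function.eval i)) (L i) (x i)) μ :=
    integrable_finsetSum _ fun i _ => (hint_i i).comp_measurable (measurable_pi_apply i)
  have hπL := pi_absolutelyContinuous_pi hac_i
  have hllr (hac : μ ≪ Measure.pi fun i => μ.map (Function.eval i)) :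
      llr μ (Measure.pi L) =ᵐ[μ] fun x => llr μ (Measure.pi fun i => μ.map (Function.eval i)) x +
        ∑ i, llr (μ.map (Function.eval i)) (L i) (x i) := by
    filter_upwards [llr_add_llr hac hπL, hac.ae_le (llr_pi hac_i)] with x hadd hpi
    rw [← hadd, Pi.add_apply, hpi]
  by_cases htop : InformationTheory.klDiv μ (Measure.pi fun i => μ.map (Function.eval i)) = ⊤
  · have hbot : entropy (Measure.pi L) μ = ⊥ := by
      contrapose! htop
      obtain ⟨hac, hint⟩ := entropy_ne_bot_iff.1 htop
      have hac' := absolutelyContinuous_pi_map_eval hac hac_i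
      refine InformationTheory.klDiv_ne_top hac' ?_
      rwa [integrable_congr (hllr hac'), integrable_add_iff_integrable_left' hsum] at hint
    simp [hbot, htop]
  · obtain ⟨hac, hint⟩ := InformationTheory.klDiv_ne_top_iff.1 htop
    rw [entropy_eq_neg_integral_llr (hac.trans hπL)
        ((integrable_congr (hllr hac)).2 (hint.add hsum)), integral_congr_ae (hllr hac),
      integral_add hint hsum, neg_add, EReal.coe_add, EReal.coe_neg,
      ← InformationTheory.toReal_klDiv_of_measure_eq hac (by simp),
      EReal.coe_ennreal_toReal htop]

theorem entropy_pi_eq_neg_klDiv_add :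
    entropy (Measure.pi L) μ =
      -(InformationTheory.klDiv μ (Measure.pi fun i => μ.map (Function.eval i)) : EReal) +
        ∑ i, entropy (L i) (μ.map (Function.eval i)) := by
  classical
  by_cases h : ∀ i, entropy (L i) (μ.map (Function.eval i)) ≠ ⊥
  · exact entropy_pi_eq_neg_klDiv_add_of_ne_bot h
  have hbot : entropy (Measure.pi L) μ = ⊥ := by
    contrapose! h
    exact entropy_map_eval_ne_bot h
  push Not at h
  obtain ⟨i, hi⟩ := h
  rw [hbot, ← Finset.add_sum_erase _ _ (Finset.mem_univ i), hi, EReal.bot_add, EReal.add_bot]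

end Entropy

section Box

variable {R : ℝ} {n : ℕ} (μ : Measure (Box R n)) [IsProbabilityMeasure μ]

instance isFiniteMeasure_lebesgueInterval (R : ℝ) : IsFiniteMeasure (lebesgueInterval R) where
  measure_univ_lt_top := by
    rw [lebesgueInterval, (MeasurableEmbedding.subtype_coe measurableSet_Icc).comap_apply,
      Set.image_univ, Subtype.range_coe, Real.volume_Icc]
    exact ENNReal.ofReal_lt_top

theorem entropyBox_eq_neg_klDiv_add :
    entropyBox μ = -(InformationTheory.klDiv μ (Measure.pi (marginal μ)) : EReal) +
      ∑ i, entropyInterval (marginal μ i) :=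
  entropy_pi_eq_neg_klDiv_add

variable {μ} {Ξ : (N : ℕ) → Fin n → Fin N → Interval R}

theorem legendreISym_eq_klDiv (hΞ : IsApproximating (marginal μ) Ξ) :
    legendreISym μ Ξ = (InformationTheory.klDiv μ (Measure.pi (marginal μ)) : EReal) :=
  ((legendreISym_le_ISym μ Ξ).trans (ISym_le_klDiv μ hΞ)).antisymm (klDiv_le_legendreISym μ hΞ)

theorem ISym_eq_klDiv (hΞ : IsApproximating (marginal μ) Ξ) :
    ISym μ Ξ = (InformationTheory.klDiv μ (Measure.pi (marginal μ)) : EReal) :=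
  (ISym_le_klDiv μ hΞ).antisymm ((klDiv_le_legendreISym μ hΞ).trans (legendreISym_le_ISym μ Ξ))

theorem eq_pi_marginal_iff_iIndepFun :
    μ = Measure.pi (marginal μ) ↔
      ProbabilityTheory.iIndepFun (fun (i : Fin n) (x : Box R n) => x i) μ := by
  rw [ProbabilityTheory.iIndepFun_iff_map_fun_eq_pi_map
    fun i => (measurable_pi_apply i).aemeasurable, Measure.map_id']
  rfl

end Box

end MutualPressure

open MutualPressure in
theorem theorem3p5_general {R : ℝ} {n : ℕ} (μ : Measure (Box R n)) [IsProbabilityMeasure μ]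
    {Ξ Ξ' : (N : ℕ) → Fin n → Fin N → Interval R} (hΞ : IsApproximating (marginal μ) Ξ)
    (hΞ' : IsApproximating (marginal μ) Ξ') :
    entropyBox μ = -legendreISym μ Ξ + ∑ i, entropyInterval (marginal μ i) ∧
      legendreISym μ Ξ = ISym μ Ξ' ∧
      ISym μ Ξ' = (InformationTheory.klDiv μ (Measure.pi (marginal μ)) : EReal) ∧
      (legendreISym μ Ξ = 0 ↔ μ = Measure.pi (marginal μ)) ∧
      (μ = Measure.pi (marginal μ) ↔
        ProbabilityTheory.iIndepFun (fun (i : Fin n) (x : Box R n) => x i) μ) := by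
  rw [legendreISym_eq_klDiv hΞ, ISym_eq_klDiv hΞ', EReal.coe_ennreal_eq_zero,
    InformationTheory.klDiv_eq_zero_iff]
  exact ⟨entropyBox_eq_neg_klDiv_add μ, rfl, rfl, Iff.rfl, eq_pi_marginal_iff_iIndepFun⟩

theorem theorem3p5 (R : ℝ) (hR : 0 < R) (n : ℕ) (hn : 1 ≤ n)
    (μ : MeasureTheory.Measure (MutualPressure.Box R n)) [MeasureTheory.IsProbabilityMeasure μ]
    (Ξ Ξ' : (N : ℕ) → Fin n → Fin N → MutualPressure.Interval R)
    (hΞ : MutualPressure.IsApproximating (MutualPressure.marginal μ) Ξ)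
    (hΞ' : MutualPressure.IsApproximating (MutualPressure.marginal μ) Ξ') :
    MutualPressure.entropyBox μ =
        -MutualPressure.legendreISym μ Ξ
          + ∑ i, MutualPressure.entropyInterval (MutualPressure.marginal μ i) ∧
    ((∀ i, ⊥ < MutualPressure.entropyInterval (MutualPressure.marginal μ i)) →
      MutualPressure.legendreISym μ Ξ = MutualPressure.ISym μ Ξ' ∧
      MutualPressure.ISym μ Ξ' =
        ((InformationTheory.klDiv μ
          (MeasureTheory.Measure.pi (MutualPressure.marginal μ)) : ENNReal) : EReal) ∧
      (MutualPressure.legendreISym μ Ξ = 0 ↔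
        μ = MeasureTheory.Measure.pi (MutualPressure.marginal μ)) ∧
      (μ = MeasureTheory.Measure.pi (MutualPressure.marginal μ) ↔
        ProbabilityTheory.iIndepFun
          (fun (i : Fin n) (x : MutualPressure.Box R n) => x i) μ)) := by
  have h := theorem3p5_general μ hΞ hΞ'
  exact ⟨h.1, fun _ => h.2⟩
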